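/- Let $d\ge 1$ and let $X=(X_t)_{t\ge 0}$ be an isotropic L\'evy process in $\mathbb R^d$ with characteristic exponent $\xi\mapsto\psi(|\xi|)$, that is, $\mathbb E[e^{i\xi\cdot X_t}]=e^{-t\psi(|\xi|)}$ for all $t\ge 0$ and $\xi\in\mathbb R^d$. Assume that $X$ is unimodal: for every $t>0$ the law of $X_t$ has on $\mathbb R^d\setminus\{0\}$ a density $p(t,x)=q(t,|x|)$ such that $r\mapsto q(t,r)$ is non-increasing on $(0,\infty)$. For $\lambda>0$ put $$\phi(\lambda)=(4\pi)^{-d/2}\int_{\mathbb R^d}e^{-|\xi|^2/4}\,\psi(|\xi|\sqrt\lambda)\,d\xi,\qquad H(\lambda)=\phi(\lambda)-\lambda\phi'(\lambda).$$ A function $\ell:(0,\infty)\to(0,\infty)$ is said to vary regularly at $0$ (at $\infty$) with index $\alpha$ if $\ell(\lambda s)/\ell(s)\to\lambda^\alpha$ as $s\to 0$ ($s\to\infty$, respectively) for every $\lambda>0$. Assume that $H$ varies regularly at $0$ (at $\infty$, respectively) with index $\gamma\in[0,2)$ and that $\psi$ varies regularly at $0$ (at $\infty$, respectively) with index $\gamma_1\in[0,2]$;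 in particular $H$ and $\psi$ are positive on $(0,\infty)$. Then $$\frac{p(t,x)}{t\,|x|^{-d}\,H(|x|^{-2})}\longrightarrow\frac{\gamma\,\pi^{-d/2}\,\Gamma(d/2)}{\Gamma(2-\gamma)}$$ as $|x|\to\infty$ ($x\to 0$, $x\neq 0$, respectively) and $t\,\psi(|x|^{-1})^2/H(|x|^{-2})\to 0$, the limit being taken jointly in $t>0$ and $x$. -/

import Mathlib

open MeasureTheory ProbabilityTheory Filter Topology Set
open scoped NNReal ENNReal

/-- A Lévy process in a Euclidean space (time set `[0, ∞)`): it starts at `0`, has independent and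
stationary increments, and is stochastically continuous. -/
structure IsLevyProcess {Ω : Type*} [MeasurableSpace Ω] (P : Measure Ω) {d : ℕ}
    (X : ℝ≥0 → Ω → EuclideanSpace ℝ (Fin d)) : Prop where
  aemeasurable : ∀ t, AEMeasurable (X t) P
  start_zero : ∀ᵐ ω ∂P, X 0 ω = 0
  indep_increments : HasIndepIncrements X P
  stationary_increments : ∀ s h : ℝ≥0, IdentDistrib (X (s + h) - X s) (X h) P P
  stochastically_continuous : ∀ t : ℝ≥0, TendstoInMeasure P X (𝓝 t) (X t)

/-- `ξ ↦ ψ(|ξ|)` is the characteristic exponent of `X`: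
`E[exp(i ξ · X_t)] = exp(-t ψ(|ξ|))` for all `t ≥ 0` and all `ξ`. -/
def HasRadialCharExponent {Ω : Type*} [MeasurableSpace Ω] (P : Measure Ω) {d : ℕ}
    (X : ℝ≥0 → Ω → EuclideanSpace ℝ (Fin d)) (ψ : ℝ → ℝ) : Prop :=
  ∀ (t : ℝ≥0) (ξ : EuclideanSpace ℝ (Fin d)),
    charFun (P.map (X t)) ξ = ((Real.exp (-(t * ψ ‖ξ‖)) : ℝ) : ℂ)

/-- `X` is unimodal with transition density `p`: for every `t > 0` the law of `X_t` has, on the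
complement of the origin, the density `p(t,x) = q(t,|x|)` with `r ↦ q(t,r)` non-increasing
on `(0, ∞)`. The value at the origin is unrestricted (the density may blow up there, and the law
may have an atom there). -/
def IsUnimodalWithDensity {Ω : Type*} [MeasurableSpace Ω] (P : Measure Ω) {d : ℕ}
    (X : ℝ≥0 → Ω → EuclideanSpace ℝ (Fin d))
    (p : ℝ≥0 → EuclideanSpace ℝ (Fin d) → ℝ) : Prop :=
  ∃ q : ℝ≥0 → ℝ → ℝ, ∀ t : ℝ≥0, 0 < t →
    AntitoneOn (q t) (Ioi 0) ∧ (∀ r : ℝ, 0 < r → 0 ≤ q t r) ∧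
    (∀ x : EuclideanSpace ℝ (Fin d), x ≠ 0 → p t x = q t ‖x‖) ∧
    (P.map (X t)).restrict {0}ᶜ
      = (volume : Measure (EuclideanSpace ℝ (Fin d))).withDensity
          (fun x => ENNReal.ofReal (p t x))

/-- A function `ℓ : (0, ∞) → (0, ∞)` varies regularly with index `α` along `F`; here
`F = atTop` is regular variation at infinity and `F = 𝓝[>] 0` is regular variation at zero. -/
def RegularlyVaries (ℓ : ℝ → ℝ) (F : Filter ℝ) (α : ℝ) : Prop :=
  (∀ s : ℝ, 0 < s → 0 < ℓ s) ∧
    ∀ c : ℝ, 0 < c → Tendsto (fun s => ℓ (c * s) / ℓ s) F (𝓝 (c ^ α))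

/-- `φ(s) = (4π)^{-d/2} ∫ exp(-|ξ|²/4) ψ(|ξ| √s) dξ`, the integral being over `ℝ^d`. -/
noncomputable def gaussianAverage (d : ℕ) (ψ : ℝ → ℝ) (s : ℝ) : ℝ :=
  (4 * Real.pi) ^ (-(d : ℝ) / 2) *
    ∫ ξ : EuclideanSpace ℝ (Fin d), Real.exp (-‖ξ‖ ^ 2 / 4) * ψ (‖ξ‖ * √s)

/-- `H(s) = φ(s) - s φ'(s)`. -/
noncomputable def auxH (d : ℕ) (ψ : ℝ → ℝ) (s : ℝ) : ℝ :=
  gaussianAverage d ψ s - s * deriv (gaussianAverage d ψ) s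

/-- The limiting regime for pairs `(t, x)` with `t > 0`: simultaneously `|x|` tends along `F`
and `h(t, |x|) → 0`. -/
noncomputable def jointLimit {d : ℕ} (F : Filter ℝ) (h : ℝ≥0 → ℝ → ℝ) :
    Filter (ℝ≥0 × EuclideanSpace ℝ (Fin d)) :=
  comap (fun z => ‖z.2‖) F ⊓ comap (fun z => h z.1 ‖z.2‖) (𝓝 0) ⊓ 𝓟 {z | 0 < z.1}

/-! The proof is a Tauberian argument for the law of `|X_t|²`, followed by a monotone-density
argument that uses unimodality a second time.

Averaging the identity for `E[1 - cos(ξ·X_t)]` against a Gaussian in `ξ` gives `E[1 -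
exp(-l|X_t|²)]`. Applying the operator `g ↦ g - l g'` to both sides expresses `E[K(l|X_t|²)]`, with
`K(u) = 1 - e^{-u} - u e^{-u}`, through `1 - e^{-tψ}`. Linearising the exponential replaces it by `t
H(l)` with error `O((t ψ(√l))²)` (`exists_abs_integral_truncKernel_sub_le`). The uniformity of this
error rests on `psi_mul_le`, a quadratic growth bound for `ψ` obtained from unimodality.

With `l = c|x|^{-2}`, after division by `t H(|x|^{-2})`, the error vanishes in the joint limit and
regular variation of `H` leaves `c^γ`. A Karamata theorem for the kernel `K`
(`tendsto_integral_comp_exp_neg`) then shows that the rescaled law of `|X_t|²/|x|²`, tested against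
suitable functions, converges to `γ/Γ(2-γ) · u^{-1-γ} du`. Testing with bumps supported just outside
or just inside `u = 1`, and comparing the density there with its value at `x` by monotonicity,
bounds `p(t,x)` from below and from above (`tendsto_density_ratio`). The constant comes from writing
Lebesgue measure in the variable `|y|²`. -/

/-- The measure `μ` has, off the origin, the density `w`, which is radially non-increasing. -/
structure IsUnimodalMeasure {E : Type*} [NormedAddCommGroup E] [MeasureSpace E]
    (μ : Measure E) (w : E → ℝ≥0∞) : Prop where
  aemeasurable : AEMeasurable w
  anti : ∀ x y : E, x ≠ 0 → ‖x‖ ≤ ‖y‖ → w y ≤ w x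
  restrict_eq : μ.restrict {0}ᶜ = volume.withDensity w

/-! ### Cosine inequalities for unimodal measures. -/

namespace IsUnimodalMeasure

section General

variable {E : Type*} [NormedAddCommGroup E] [MeasureSpace E] [BorelSpace E] {μ : Measure E}
  {w : E → ℝ≥0∞}

/-- Vanishing of `f` at `0` hides a possible atom of `μ` there. -/
lemma lintegral_eq (h : IsUnimodalMeasure μ w) {f : E → ℝ≥0∞} (hf : Measurable f) (h0 : f 0 = 0) :
    ∫⁻ y, f y ∂μ = ∫⁻ y, w y * f y := by
  have h1 : ∫⁻ y, f y ∂μ = ∫⁻ y in ({0}ᶜ : Set E), f y ∂μ := by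
    rw [← lintegral_add_compl f (measurableSet_singleton (0 : E))]
    simp [h0]
  rw [h1, h.restrict_eq, lintegral_withDensity_eq_lintegral_mul₀ h.aemeasurable hf.aemeasurable]
  rfl

end General

variable {E : Type*} [NormedAddCommGroup E] [InnerProductSpace ℝ E] [FiniteDimensional ℝ E]
  [MeasurableSpace E] [BorelSpace E] {μ : Measure E} {w : E → ℝ≥0∞}

/-- Translation by `v = πη/|η|²` raises the inner product with `η` by `π`, turning `1 + cos` into `1
- cos`. On the half-space where that product is positive, it also increases the norm, so the density
does not grow. -/
lemma setLIntegral_one_add_cos_le (h : IsUnimodalMeasure μ w) {η : E} (hη : η ≠ 0) :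
    ∫⁻ y in {y | Real.pi < inner ℝ η y}, ENNReal.ofReal (1 + Real.cos (inner ℝ η y)) ∂μ
      ≤ ∫⁻ y in {y | 0 < inner ℝ η y}, ENNReal.ofReal (1 - Real.cos (inner ℝ η y)) ∂μ := by
  have hmeas (a : ℝ) : MeasurableSet {y : E | a < inner ℝ η y} :=
    measurableSet_lt measurable_const (by fun_prop)
  rw [← lintegral_indicator (hmeas _), ← lintegral_indicator (hmeas _),
    h.lintegral_eq (Measurable.indicator (by fun_prop) (hmeas _)),
    h.lintegral_eq (Measurable.indicator (by fun_prop) (hmeas _))]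
  · set v : E := (Real.pi / ‖η‖ ^ 2) • η with hv
    have hnorm : ‖η‖ ≠ 0 := norm_ne_zero_iff.mpr hη
    have hiv : inner ℝ η v = Real.pi := by
      rw [hv, inner_smul_right, real_inner_self_eq_norm_sq]
      field_simp
    rw [← lintegral_add_right_eq_self _ v]
    refine lintegral_mono fun z => ?_
    by_cases hz : 0 < inner ℝ η z
    · have hz' : Real.pi < inner ℝ η (z + v) := by rw [inner_add_right, hiv]; linarith
      simp only [indicator, mem_ofPred_eq, hz, hz', if_true]
      rw [inner_add_right, hiv, Real.cos_add_pi, ← sub_eq_add_neg]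
      gcongr
      refine h.anti _ _ ?_ ?_
      · rintro rfl
        simp at hz
      · have h1 : 0 ≤ inner ℝ z v := by
          rw [hv, inner_smul_right, real_inner_comm]
          positivity
        have h2 := norm_add_sq_real z v
        nlinarith [norm_nonneg z, norm_nonneg (z + v), sq_nonneg ‖v‖]
    · have hz' : ¬ Real.pi < inner ℝ η (z + v) := by rw [inner_add_right, hiv]; linarith
      simp [indicator, hz']
  all_goals simp [indicator, Real.pi_pos.le]

/-- The integrals of `1 + cos` and `1 - cos` over the set on the left are both at most the
right-hand side, and their sum is twice the measure of that set. -/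
lemma measure_pi_lt_inner_le (h : IsUnimodalMeasure μ w) {η : E} (hη : η ≠ 0) :
    μ {y | Real.pi < inner ℝ η y}
      ≤ ∫⁻ y in {y | 0 < inner ℝ η y}, ENNReal.ofReal (1 - Real.cos (inner ℝ η y)) ∂μ := by
  have h1 := h.setLIntegral_one_add_cos_le hη
  have h2 : ∫⁻ y in {y | Real.pi < inner ℝ η y}, ENNReal.ofReal (1 - Real.cos (inner ℝ η y)) ∂μ
      ≤ ∫⁻ y in {y | 0 < inner ℝ η y}, ENNReal.ofReal (1 - Real.cos (inner ℝ η y)) ∂μ :=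
    lintegral_mono_set fun y (hy : Real.pi < _) => Real.pi_pos.trans hy
  have h3 := add_le_add h1 h2
  rw [← lintegral_add_left (by fun_prop)] at h3
  have h4 (y : E) : ENNReal.ofReal (1 + Real.cos (inner ℝ η y))
      + ENNReal.ofReal (1 - Real.cos (inner ℝ η y)) = 2 := by
    rw [← ENNReal.ofReal_add (by linarith [Real.neg_one_le_cos (inner ℝ η y)])
      (by linarith [Real.cos_le_one (inner ℝ η y)])]
    norm_num
  simp only [h4, lintegral_const, Measure.restrict_apply_univ] at h3
  rw [← two_mul] at h3
  exact (ENNReal.mul_le_mul_iff_right (by norm_num) (by norm_num)).mp h3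

lemma measure_pi_lt_abs_inner_le (h : IsUnimodalMeasure μ w) (η : E) :
    μ {y | Real.pi < |inner ℝ η y|} ≤ ∫⁻ y, ENNReal.ofReal (1 - Real.cos (inner ℝ η y)) ∂μ := by
  rcases eq_or_ne η 0 with rfl | hη
  · simp [Real.pi_pos.not_gt]
  have h1 := h.measure_pi_lt_inner_le hη
  have h2 := h.measure_pi_lt_inner_le (neg_ne_zero.mpr hη)
  simp only [inner_neg_left, Real.cos_neg] at h2
  have hset : {y : E | Real.pi < |inner ℝ η y|}
      = {y | Real.pi < inner ℝ η y} ∪ {y | Real.pi < -inner ℝ η y} := by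
    ext y
    simp [lt_abs]
  rw [hset]
  refine (measure_union_le _ _).trans ((add_le_add h1 h2).trans ?_)
  rw [← lintegral_union (measurableSet_lt (by fun_prop) (by fun_prop))]
  · exact setLIntegral_le_lintegral _ _
  · rw [Set.disjoint_left]
    intro y hy hy'
    simp only [mem_ofPred_eq] at hy hy'
    linarith

/-- Where `|⟨η,y⟩| ≤ π`, both cosines are comparable with squares, which costs the factor `π²s²/4`.
Elsewhere `1 - cos ≤ 2`, and the mass of that region is controlled by unimodality. -/
lemma integral_one_sub_cos_mul_le [IsProbabilityMeasure μ] (h : IsUnimodalMeasure μ w) (η : E)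
    (s : ℝ) :
    ∫ y, (1 - Real.cos (s * inner ℝ η y)) ∂μ
      ≤ (2 + Real.pi ^ 2 * s ^ 2 / 4) * ∫ y, (1 - Real.cos (inner ℝ η y)) ∂μ := by
  have hint (c : ℝ) : Integrable (fun y : E => 1 - Real.cos (c * inner ℝ η y)) μ := by
    refine Integrable.of_bound (C := 2) (by fun_prop) (ae_of_all _ fun y => ?_)
    rw [Real.norm_eq_abs, abs_le]
    constructor <;> linarith [Real.cos_le_one (c * inner ℝ η y),
      Real.neg_one_le_cos (c * inner ℝ η y)]
  have hint1 : Integrable (fun y : E => 1 - Real.cos (inner ℝ η y)) μ := by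
    simpa using hint 1
  have hms : MeasurableSet {y : E | Real.pi < |inner ℝ η y|} :=
    measurableSet_lt (by fun_prop) (by fun_prop)
  have hnn (a : ℝ) : 0 ≤ 1 - Real.cos a := by linarith [Real.cos_le_one a]
  have hA : μ.real {y : E | Real.pi < |inner ℝ η y|} ≤ ∫ y, (1 - Real.cos (inner ℝ η y)) ∂μ := by
    have := h.measure_pi_lt_abs_inner_le η
    rw [← ofReal_integral_eq_lintegral_ofReal hint1 (ae_of_all _ fun y => hnn _)] at this
    exact ENNReal.toReal_le_of_le_ofReal (integral_nonneg fun y => hnn _) this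
  have hpt (a : ℝ) : 1 - Real.cos (s * a)
      ≤ Real.pi ^ 2 * s ^ 2 / 4 * (1 - Real.cos a) + if Real.pi < |a| then 2 else 0 := by
    split_ifs with ha
    · have := hnn a
      have : 0 ≤ Real.pi ^ 2 * s ^ 2 / 4 * (1 - Real.cos a) := by positivity
      linarith [Real.neg_one_le_cos (s * a)]
    · have h1 := Real.cos_le_one_sub_mul_cos_sq (not_lt.mp ha)
      have h2 := Real.one_sub_sq_div_two_le_cos (x := s * a)
      have h3 : Real.pi ^ 2 * s ^ 2 / 4 * (2 / Real.pi ^ 2 * a ^ 2)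
          ≤ Real.pi ^ 2 * s ^ 2 / 4 * (1 - Real.cos a) := by
        gcongr
        linarith
      have h4 : Real.pi ^ 2 * s ^ 2 / 4 * (2 / Real.pi ^ 2 * a ^ 2) = (s * a) ^ 2 / 2 := by
        field_simp
        ring
      linarith
  have hind : Integrable ({y : E | Real.pi < |inner ℝ η y|}.indicator fun _ => (2 : ℝ)) μ :=
    (integrable_const _).indicator hms
  calc ∫ y, (1 - Real.cos (s * inner ℝ η y)) ∂μ
      ≤ ∫ y, (Real.pi ^ 2 * s ^ 2 / 4 * (1 - Real.cos (inner ℝ η y))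
        + {y : E | Real.pi < |inner ℝ η y|}.indicator (fun _ => (2 : ℝ)) y) ∂μ :=
        integral_mono (hint s) ((hint1.const_mul _).add hind) fun y => hpt _
    _ = Real.pi ^ 2 * s ^ 2 / 4 * ∫ y, (1 - Real.cos (inner ℝ η y)) ∂μ
        + μ.real {y : E | Real.pi < |inner ℝ η y|} * 2 := by
        rw [integral_add (hint1.const_mul _) hind, integral_const_mul, integral_indicator hms]
        simp
    _ ≤ _ := by linarith

end IsUnimodalMeasure

/-! ### Unimodal semigroups and the growth of the exponent. -/

/-- A convolution semigroup of probability measures with radial exponent `ψ`, all of whose members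
are unimodal. -/
structure IsUnimodalSemigroup {d : ℕ} (μ : ℝ≥0 → Measure (EuclideanSpace ℝ (Fin d)))
    (w : ℝ≥0 → EuclideanSpace ℝ (Fin d) → ℝ≥0∞) (ψ : ℝ → ℝ) : Prop where
  prob : ∀ t, IsProbabilityMeasure (μ t)
  charFun_eq : ∀ (t : ℝ≥0) (ξ : EuclideanSpace ℝ (Fin d)),
    charFun (μ t) ξ = ((Real.exp (-(t * ψ ‖ξ‖)) : ℝ) : ℂ)
  unimodal : ∀ t, 0 < t → IsUnimodalMeasure (μ t) (w t)
  dim_pos : 0 < d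

namespace IsUnimodalSemigroup

variable {d : ℕ} {μ : ℝ≥0 → Measure (EuclideanSpace ℝ (Fin d))}
  {w : ℝ≥0 → EuclideanSpace ℝ (Fin d) → ℝ≥0∞} {ψ : ℝ → ℝ}

lemma psi_norm_nonneg (h : IsUnimodalSemigroup μ w ψ) (ξ : EuclideanSpace ℝ (Fin d)) :
    0 ≤ ψ ‖ξ‖ := by
  have := h.prob 1
  have h1 := norm_charFun_le_one (μ := μ 1) ξ
  rw [h.charFun_eq, Complex.norm_real, Real.norm_eq_abs, Real.abs_exp, Real.exp_le_one_iff] at h1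
  simpa using h1

lemma exists_unit (h : IsUnimodalSemigroup μ w ψ) :
    ∃ e : EuclideanSpace ℝ (Fin d), ‖e‖ = 1 :=
  ⟨EuclideanSpace.single ⟨0, h.dim_pos⟩ 1, by simp⟩

lemma exists_norm_eq (h : IsUnimodalSemigroup μ w ψ) {r : ℝ} (hr : 0 ≤ r) :
    ∃ ξ : EuclideanSpace ℝ (Fin d), ‖ξ‖ = r := by
  obtain ⟨e, he⟩ := h.exists_unit
  exact ⟨r • e, by simp [norm_smul, he, abs_of_nonneg hr]⟩

lemma psi_nonneg (h : IsUnimodalSemigroup μ w ψ) {r : ℝ} (hr : 0 ≤ r) : 0 ≤ ψ r := by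
  obtain ⟨ξ, rfl⟩ := h.exists_norm_eq hr
  exact h.psi_norm_nonneg ξ

lemma continuous_psi_abs (h : IsUnimodalSemigroup μ w ψ) : Continuous fun r : ℝ => ψ |r| := by
  obtain ⟨e, he⟩ := h.exists_unit
  have := h.prob 1
  have h1 : (fun r : ℝ => ψ |r|) = fun r : ℝ => -Real.log (charFun (μ 1) (r • e)).re := by
    ext r
    rw [h.charFun_eq, Complex.ofReal_re, Real.log_exp]
    simp [norm_smul, he]
  rw [h1]
  refine (Continuous.log ?_ fun r => ?_).neg
  · exact Complex.continuous_re.comp (continuous_charFun.comp (by fun_prop))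
  · rw [h.charFun_eq, Complex.ofReal_re]
    exact (Real.exp_pos _).ne'

lemma integral_one_sub_cos (h : IsUnimodalSemigroup μ w ψ) (t : ℝ≥0)
    (ξ : EuclideanSpace ℝ (Fin d)) :
    ∫ y, (1 - Real.cos (inner ℝ ξ y)) ∂(μ t) = 1 - Real.exp (-(t * ψ ‖ξ‖)) := by
  have := h.prob t
  have h1 := congrArg Complex.re (h.charFun_eq t ξ)
  have hi : Integrable (fun y => Complex.exp (↑(inner ℝ y ξ) * Complex.I)) (μ t) := by
    refine Integrable.of_bound (C := 1) (by fun_prop) (ae_of_all _ fun y => ?_)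
    rw [Complex.norm_exp_ofReal_mul_I]
  have h2 : (∫ y, Complex.exp (↑(inner ℝ y ξ) * Complex.I) ∂(μ t)).re
      = ∫ y, (Complex.exp (↑(inner ℝ y ξ) * Complex.I)).re ∂(μ t) :=
    (integral_re hi).symm
  rw [charFun_apply, h2, Complex.ofReal_re] at h1
  simp only [Complex.exp_ofReal_mul_I_re] at h1
  rw [integral_sub (integrable_const _), ← h1]
  · simp [real_inner_comm]
  · simpa [Complex.exp_ofReal_mul_I_re, real_inner_comm] using hi.re

/-- The cosine inequality for `μ t` compares values of `1 - e^{-tψ}`; dividing by `t` and letting `t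
→ 0` passes to `ψ`. -/
lemma psi_mul_le (h : IsUnimodalSemigroup μ w ψ) {s r : ℝ} (hs : 0 ≤ s) (hr : 0 ≤ r) :
    ψ (s * r) ≤ (2 + Real.pi ^ 2 * s ^ 2 / 4) * ψ r := by
  obtain ⟨ξ, rfl⟩ := h.exists_norm_eq hr
  set K := 2 + Real.pi ^ 2 * s ^ 2 / 4
  have hK : 0 ≤ K := by positivity
  set a := ψ (s * ‖ξ‖)
  have ha : 0 ≤ a := h.psi_nonneg (by positivity)
  have hb : 0 ≤ ψ ‖ξ‖ := h.psi_nonneg (by positivity)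
  have key (t : ℝ≥0) (ht : 0 < t) : a ≤ K * ψ ‖ξ‖ + t * a ^ 2 := by
    have := h.prob t
    have h1 := (h.unimodal t ht).integral_one_sub_cos_mul_le ξ s
    simp_rw [← real_inner_smul_left] at h1
    rw [h.integral_one_sub_cos, h.integral_one_sub_cos, norm_smul, Real.norm_eq_abs,
      abs_of_nonneg hs] at h1
    have h2 : 1 - Real.exp (-(t * ψ ‖ξ‖)) ≤ t * ψ ‖ξ‖ := by
      linarith [Real.add_one_le_exp (-(t * ψ ‖ξ‖))]
    have ht' : (0 : ℝ) < t := ht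
    -- For `x ≥ 0`, `e^{-x} ≤ 1/(1+x) ≤ 1 - x + x²`, since `(1+x)(1-x+x²) = 1 + x³`.
    have h3 : Real.exp (-(t * a)) ≤ 1 - t * a + (t * a) ^ 2 := by
      have hx : 0 ≤ t * a := by positivity
      have h4 := Real.add_one_le_exp (t * a)
      rw [Real.exp_neg]
      refine (inv_anti₀ (by linarith) h4).trans ?_
      rw [inv_le_iff_one_le_mul₀ (by linarith)]
      nlinarith [pow_nonneg hx 3]
    change 1 - Real.exp (-(t * a)) ≤ K * _ at h1
    have h5 : t * a - (t * a) ^ 2 ≤ K * (t * ψ ‖ξ‖) := by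
      have := mul_le_mul_of_nonneg_left h2 hK
      linarith
    have h6 : t * a ≤ t * (K * ψ ‖ξ‖ + t * a ^ 2) := by nlinarith
    exact le_of_mul_le_mul_left h6 ht'
  have hlim : Tendsto (fun t : ℝ => K * ψ ‖ξ‖ + t * a ^ 2) (𝓝[>] 0)
      (𝓝 (K * ψ ‖ξ‖ + 0 * a ^ 2)) :=
    (Continuous.tendsto (by fun_prop) 0).mono_left nhdsWithin_le_nhds
  rw [zero_mul, add_zero] at hlim
  refine ge_of_tendsto hlim ?_
  filter_upwards [self_mem_nhdsWithin] with t ht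
  exact key ⟨t, le_of_lt ht⟩ ht

end IsUnimodalSemigroup

/-! ### Gaussian averages and an integral formula for `H`. -/

section GaussianAverage

variable {d : ℕ}

lemma integrable_norm_pow_mul_exp_neg (hd : 0 < d) (k : ℕ) {b : ℝ} (hb : 0 < b) :
    Integrable fun ξ : EuclideanSpace ℝ (Fin d) => ‖ξ‖ ^ k * Real.exp (-b * ‖ξ‖ ^ 2) := by
  have : Nonempty (Fin d) := ⟨⟨0, hd⟩⟩
  rw [integrable_fun_norm_addHaar volume (f := fun y : ℝ => y ^ k * Real.exp (-b * y ^ 2))]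
  set n := Module.finrank ℝ (EuclideanSpace ℝ (Fin d)) - 1
  have h := integrableOn_rpow_mul_exp_neg_mul_sq hb (s := ((n + k : ℕ) : ℝ))
    (by linarith [(Nat.cast_nonneg (n + k) : (0 : ℝ) ≤ _)])
  refine h.congr_fun (fun y _ => ?_) measurableSet_Ioi
  simp only [Real.rpow_natCast, smul_eq_mul]
  ring

lemma integrable_exp_neg_mul_of_growth (hd : 0 < d) {b : ℝ} (hb : 0 < b)
    {g : EuclideanSpace ℝ (Fin d) → ℝ} (hg : Continuous g) {C : ℝ} {k : ℕ}
    (hC : ∀ ξ, |g ξ| ≤ C * (1 + ‖ξ‖ ^ 2) ^ k) :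
    Integrable fun ξ : EuclideanSpace ℝ (Fin d) => Real.exp (-b * ‖ξ‖ ^ 2) * g ξ := by
  have hC0 : 0 ≤ C := by
    have := (abs_nonneg _).trans (hC 0)
    simpa using this
  have h := ((integrable_norm_pow_mul_exp_neg hd 0 hb).add
    (integrable_norm_pow_mul_exp_neg hd (2 * k) hb)).const_mul (C * 2 ^ (k - 1))
  refine h.mono' (by fun_prop) (ae_of_all _ fun ξ => ?_)
  rw [Real.norm_eq_abs, abs_mul, Real.abs_exp]
  have h1 := add_pow_le (zero_le_one (α := ℝ)) (sq_nonneg ‖ξ‖) k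
  have h2 := (hC ξ).trans (mul_le_mul_of_nonneg_left h1 hC0)
  refine (mul_le_mul_of_nonneg_left h2 (Real.exp_pos _).le).trans (le_of_eq ?_)
  simp only [Pi.add_apply, one_pow, pow_zero, pow_mul]
  ring

lemma integral_comp_sqrt_smul {l : ℝ} (hl : 0 < l) (g : EuclideanSpace ℝ (Fin d) → ℝ) :
    ∫ ξ, g (√l • ξ) = l ^ (-(d : ℝ) / 2) * ∫ ξ, g ξ := by
  rw [Measure.integral_comp_smul, finrank_euclideanSpace_fin, smul_eq_mul, Real.sqrt_eq_rpow,
    ← Real.rpow_natCast, ← Real.rpow_mul hl.le, ← Real.rpow_neg hl.le, abs_of_pos (by positivity)]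
  congr 2
  ring

/-- Rescaling moves the parameter from `f` to the Gaussian, so differentiating in `l` requires no
smoothness of `f`. -/
lemma gaussianAverage_eq_rpow_mul {l : ℝ} (hl : 0 < l) (f : ℝ → ℝ) :
    gaussianAverage d f l = (4 * Real.pi) ^ (-(d : ℝ) / 2) * (l ^ (-(d : ℝ) / 2) *
      ∫ ξ : EuclideanSpace ℝ (Fin d), Real.exp (-‖ξ‖ ^ 2 / (4 * l)) * f ‖ξ‖) := by
  rw [gaussianAverage, ← integral_comp_sqrt_smul hl]
  congr 2
  ext ξ
  rw [norm_smul, Real.norm_eq_abs, abs_of_nonneg (Real.sqrt_nonneg l), mul_pow, Real.sq_sqrt hl.le,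
    mul_comm ‖ξ‖]
  congr 2
  field_simp

lemma hasDerivAt_integral_exp_neg_div (hd : 0 < d) {f : ℝ → ℝ} (hf : Continuous fun r => f |r|)
    {C : ℝ} (hC : ∀ r, 0 ≤ r → |f r| ≤ C * (1 + r ^ 2)) {l : ℝ} (hl : 0 < l) :
    HasDerivAt (fun u => ∫ ξ : EuclideanSpace ℝ (Fin d), Real.exp (-‖ξ‖ ^ 2 / (4 * u)) * f ‖ξ‖)
      (∫ ξ : EuclideanSpace ℝ (Fin d),
        Real.exp (-‖ξ‖ ^ 2 / (4 * l)) * (‖ξ‖ ^ 2 / (4 * l ^ 2) * f ‖ξ‖)) l := by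
  have hfn : Continuous fun ξ : EuclideanSpace ℝ (Fin d) => f ‖ξ‖ := by
    simpa only [Function.comp_def, abs_norm] using hf.comp (continuous_norm (E := EuclideanSpace ℝ (Fin d)))
  have hexp (u : ℝ) (hu : 0 < u) (ξ : EuclideanSpace ℝ (Fin d)) :
      Real.exp (-‖ξ‖ ^ 2 / (4 * u)) = Real.exp (-(1 / (4 * u)) * ‖ξ‖ ^ 2) := by
    congr 1
    field_simp
  -- On this interval `u < 2l` bounds the Gaussian by the one with rate `1/(8l)`, and `u > l/2`
  -- gives `4u² ≥ l²`.
  refine (hasDerivAt_integral_of_dominated_loc_of_deriv_le (s := Ioo (l / 2) (2 * l))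
    (bound := fun ξ => Real.exp (-(1 / (8 * l)) * ‖ξ‖ ^ 2) * (‖ξ‖ ^ 2 / l ^ 2 * |f ‖ξ‖|))
    (F' := fun u ξ => Real.exp (-‖ξ‖ ^ 2 / (4 * u)) * (‖ξ‖ ^ 2 / (4 * u ^ 2) * f ‖ξ‖))
    (Ioo_mem_nhds (by linarith) (by linarith)) ?_ ?_ ?_ ?_ ?_ ?_).2
  · exact Eventually.of_forall fun u =>
      (Continuous.mul (by fun_prop) hfn).aestronglyMeasurable
  · simp_rw [hexp l hl]
    exact integrable_exp_neg_mul_of_growth hd (by positivity) hfn (k := 1) (C := C)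
      fun ξ => by simpa using hC _ (norm_nonneg ξ)
  · exact (Continuous.mul (by fun_prop) (Continuous.mul (by fun_prop) hfn)).aestronglyMeasurable
  · refine ae_of_all _ fun ξ u hu => ?_
    have hu0 : 0 < u := by linarith [hu.1]
    rw [norm_mul, norm_mul, Real.norm_eq_abs, Real.norm_eq_abs, Real.norm_eq_abs, Real.abs_exp,
      abs_of_nonneg (by positivity : 0 ≤ ‖ξ‖ ^ 2 / (4 * u ^ 2))]
    gcongr ?_ * (?_ * _)
    · rw [hexp u hu0]
      gcongr Real.exp ?_
      have : 1 / (8 * l) ≤ 1 / (4 * u) := by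
        apply one_div_le_one_div_of_le (by linarith)
        linarith [hu.2]
      nlinarith [sq_nonneg ‖ξ‖]
    · gcongr
      nlinarith [hu.1]
  · refine integrable_exp_neg_mul_of_growth hd (by positivity)
      (Continuous.mul (by fun_prop) hfn.abs) (k := 2) (C := C / l ^ 2) fun ξ => ?_
    rw [abs_mul, abs_abs, abs_of_nonneg (by positivity)]
    have h1 := hC _ (norm_nonneg ξ)
    have h2 : ‖ξ‖ ^ 2 / l ^ 2 ≤ (1 + ‖ξ‖ ^ 2) / l ^ 2 := by gcongr; linarith
    refine (mul_le_mul h2 h1 (abs_nonneg _) (by positivity)).trans (le_of_eq ?_)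
    ring
  · refine ae_of_all _ fun ξ u hu => ?_
    have hu0 : 0 < u := by linarith [hu.1]
    have h1 : HasDerivAt (fun u : ℝ => -‖ξ‖ ^ 2 / (4 * u)) (‖ξ‖ ^ 2 / (4 * u ^ 2)) u := by
      have h2 := ((hasDerivAt_id u).const_mul 4).inv (by simpa using hu0.ne')
      have h3 := h2.const_mul (-‖ξ‖ ^ 2)
      convert! h3 using 1
      simp only [id]
      field_simp
    have := h1.exp.mul_const (f ‖ξ‖)
    convert! this using 1
    ring

/-- In the weight, `d/2` comes from differentiating `l^{-d/2}` and `|ξ|²/4` from differentiating the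
Gaussian. The formula is linear in `f`, so it can be compared for `1 - e^{-tψ}` and `tψ`. -/
lemma auxH_eq_integral (hd : 0 < d) {f : ℝ → ℝ} (hf : Continuous fun r => f |r|)
    {C : ℝ} (hC : ∀ r, 0 ≤ r → |f r| ≤ C * (1 + r ^ 2)) {l : ℝ} (hl : 0 < l) :
    auxH d f l = (4 * Real.pi) ^ (-(d : ℝ) / 2) * ∫ ξ : EuclideanSpace ℝ (Fin d),
      Real.exp (-‖ξ‖ ^ 2 / 4) * ((1 + d / 2 - ‖ξ‖ ^ 2 / 4) * f (‖ξ‖ * √l)) := by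
  have hfn : Continuous fun ξ : EuclideanSpace ℝ (Fin d) => f ‖ξ‖ := by
    simpa only [Function.comp_def, abs_norm] using hf.comp (continuous_norm (E := EuclideanSpace ℝ (Fin d)))
  have hexp (ξ : EuclideanSpace ℝ (Fin d)) :
      Real.exp (-‖ξ‖ ^ 2 / (4 * l)) = Real.exp (-(1 / (4 * l)) * ‖ξ‖ ^ 2) := by
    congr 1
    field_simp
  set M := ∫ ξ : EuclideanSpace ℝ (Fin d), Real.exp (-‖ξ‖ ^ 2 / (4 * l)) * f ‖ξ‖
  set M' := ∫ ξ : EuclideanSpace ℝ (Fin d),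
    Real.exp (-‖ξ‖ ^ 2 / (4 * l)) * (‖ξ‖ ^ 2 / (4 * l ^ 2) * f ‖ξ‖)
  have hM := hasDerivAt_integral_exp_neg_div hd hf hC hl
  have hpow := Real.hasDerivAt_rpow_const (x := l) (p := -(d : ℝ) / 2) (Or.inl hl.ne')
  have hder : HasDerivAt (gaussianAverage d f) ((4 * Real.pi) ^ (-(d : ℝ) / 2) *
      (-(d : ℝ) / 2 * l ^ (-(d : ℝ) / 2 - 1) * M + l ^ (-(d : ℝ) / 2) * M')) l := by
    refine ((hpow.mul hM).const_mul _).congr_of_eventuallyEq ?_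
    filter_upwards [lt_mem_nhds hl] with u hu
    exact gaussianAverage_eq_rpow_mul hu f
  have hi1 : Integrable fun ξ : EuclideanSpace ℝ (Fin d) =>
      Real.exp (-‖ξ‖ ^ 2 / (4 * l)) * f ‖ξ‖ := by
    simp_rw [hexp]
    exact integrable_exp_neg_mul_of_growth hd (by positivity) hfn (k := 1) (C := C)
      fun ξ => by simpa using hC _ (norm_nonneg ξ)
  have hi2 : Integrable fun ξ : EuclideanSpace ℝ (Fin d) =>
      Real.exp (-‖ξ‖ ^ 2 / (4 * l)) * (‖ξ‖ ^ 2 / (4 * l ^ 2) * f ‖ξ‖) := by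
    simp_rw [hexp]
    refine integrable_exp_neg_mul_of_growth hd (by positivity)
      (Continuous.mul (by fun_prop) hfn) (k := 2) (C := C / (4 * l ^ 2)) fun ξ => ?_
    rw [abs_mul, abs_of_nonneg (by positivity)]
    have h1 := hC _ (norm_nonneg ξ)
    have h2 : ‖ξ‖ ^ 2 / (4 * l ^ 2) ≤ (1 + ‖ξ‖ ^ 2) / (4 * l ^ 2) := by gcongr; linarith
    refine (mul_le_mul h2 h1 (abs_nonneg _) (by positivity)).trans (le_of_eq ?_)
    ring
  have hcv := integral_comp_sqrt_smul hl fun ξ : EuclideanSpace ℝ (Fin d) =>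
    Real.exp (-‖ξ‖ ^ 2 / (4 * l)) * ((1 + d / 2 - ‖ξ‖ ^ 2 / (4 * l)) * f ‖ξ‖)
  have hsplit : ∫ ξ : EuclideanSpace ℝ (Fin d),
      Real.exp (-‖ξ‖ ^ 2 / (4 * l)) * ((1 + d / 2 - ‖ξ‖ ^ 2 / (4 * l)) * f ‖ξ‖)
      = (1 + d / 2) * M - l * M' := by
    rw [← integral_const_mul, ← integral_const_mul,
      ← integral_sub (hi1.const_mul _) (hi2.const_mul _)]
    congr 1
    ext ξ
    field_simp
  have hlhs : ∀ ξ : EuclideanSpace ℝ (Fin d),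
      Real.exp (-‖ξ‖ ^ 2 / 4) * ((1 + d / 2 - ‖ξ‖ ^ 2 / 4) * f (‖ξ‖ * √l))
      = Real.exp (-‖√l • ξ‖ ^ 2 / (4 * l)) *
        ((1 + d / 2 - ‖√l • ξ‖ ^ 2 / (4 * l)) * f ‖√l • ξ‖) := by
    intro ξ
    rw [norm_smul, Real.norm_eq_abs, abs_of_nonneg (Real.sqrt_nonneg l), mul_pow,
      Real.sq_sqrt hl.le, mul_comm ‖ξ‖, mul_div_mul_comm, show -(l * ‖ξ‖ ^ 2) / (4 * l)
        = -‖ξ‖ ^ 2 / 4 by field_simp, show l / 4 * (‖ξ‖ ^ 2 / l) = ‖ξ‖ ^ 2 / 4 by field_simp]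
  simp_rw [hlhs]
  rw [hcv, hsplit, auxH, hder.deriv, gaussianAverage_eq_rpow_mul hl]
  change _ * (_ * M) - _ = _
  rw [Real.rpow_sub_one hl.ne']
  field_simp
  ring

end GaussianAverage

/-! ### From the exponent to the law of `|X_t|²`. -/

lemma integral_exp_neg_mul_cos {d : ℕ} {l : ℝ} (hl : 0 ≤ l) (y : EuclideanSpace ℝ (Fin d)) :
    ∫ ξ : EuclideanSpace ℝ (Fin d), Real.exp (-‖ξ‖ ^ 2 / 4) * Real.cos (√l * inner ℝ y ξ)
      = (4 * Real.pi) ^ ((d : ℝ) / 2) * Real.exp (-(l * ‖y‖ ^ 2)) := by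
  have hb : 0 < ((1 / 4 : ℝ) : ℂ).re := by norm_num [Complex.ofReal_re]
  have hi := GaussianFourier.integrable_cexp_neg_mul_sq_norm_add hb (√l * Complex.I) y
  have h := GaussianFourier.integral_cexp_neg_mul_sq_norm_add hb (√l * Complex.I) y
  have hr := congrArg Complex.re h
  rw [finrank_euclideanSpace_fin] at hr
  have h1 : ((Real.pi : ℂ) / ((1 / 4 : ℝ) : ℂ)) ^ ((d : ℂ) / 2) *
      Complex.exp ((√l * Complex.I) ^ 2 * ‖y‖ ^ 2 / (4 * ((1 / 4 : ℝ) : ℂ)))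
      = (((4 * Real.pi) ^ ((d : ℝ) / 2) * Real.exp (-(l * ‖y‖ ^ 2)) : ℝ) : ℂ) := by
    have h2 : (Real.pi : ℂ) / ((1 / 4 : ℝ) : ℂ) = ((4 * Real.pi : ℝ) : ℂ) := by
      push_cast; ring
    have h3 : ((√l : ℝ) : ℂ) ^ 2 = (l : ℂ) := by
      rw [← Complex.ofReal_pow, Real.sq_sqrt hl]
    rw [h2, Complex.ofReal_mul ((4 * Real.pi) ^ ((d : ℝ) / 2)), Complex.ofReal_cpow (by positivity), Complex.ofReal_exp, mul_pow,
      Complex.I_sq, h3]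
    push_cast
    congr 2
    ring
  rw [h1, Complex.ofReal_re] at hr
  rw [← hr]
  refine Eq.trans ?_ (integral_re hi)
  congr 1
  ext ξ
  have h4 : -((1 / 4 : ℝ) : ℂ) * (‖ξ‖ : ℂ) ^ 2 + √l * Complex.I * (inner ℝ y ξ : ℝ)
      = ((-‖ξ‖ ^ 2 / 4 : ℝ) : ℂ) + ((√l * inner ℝ y ξ : ℝ) : ℂ) * Complex.I := by
    push_cast
    ring
  rw [h4, Complex.exp_add, ← Complex.ofReal_exp]
  exact (by rw [Complex.re_ofReal_mul, Complex.exp_ofReal_mul_I_re] :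
    _ = (((Real.exp (-‖ξ‖ ^ 2 / 4) : ℝ) : ℂ) *
      Complex.exp (((√l * inner ℝ y ξ : ℝ) : ℂ) * Complex.I)).re)

/-- The kernel `1 - e^{-u} - u e^{-u}`. -/
noncomputable def truncKernel (u : ℝ) : ℝ := 1 - Real.exp (-u) - u * Real.exp (-u)

namespace IsUnimodalSemigroup

variable {d : ℕ} {μ : ℝ≥0 → Measure (EuclideanSpace ℝ (Fin d))}
  {w : ℝ≥0 → EuclideanSpace ℝ (Fin d) → ℝ≥0∞} {ψ : ℝ → ℝ}

/-- Fubini: `1 - e^{-tψ}` is the `μ t`-integral of `1 - cos`, and a Gaussian average of the cosine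
is again a Gaussian. -/
lemma gaussianAverage_one_sub_exp (h : IsUnimodalSemigroup μ w ψ) (t : ℝ≥0) {l : ℝ} (hl : 0 < l) :
    gaussianAverage d (fun r => 1 - Real.exp (-(t * ψ r))) l
      = ∫ y, (1 - Real.exp (-(l * ‖y‖ ^ 2))) ∂(μ t) := by
  have := h.prob t
  have h1 (ξ : EuclideanSpace ℝ (Fin d)) :
      Real.exp (-‖ξ‖ ^ 2 / 4) * (1 - Real.exp (-(t * ψ (‖ξ‖ * √l))))
      = ∫ y, Real.exp (-‖ξ‖ ^ 2 / 4) * (1 - Real.cos (√l * inner ℝ y ξ)) ∂(μ t) := by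
    rw [integral_const_mul]
    congr 1
    have := h.integral_one_sub_cos t (√l • ξ)
    rw [norm_smul, Real.norm_eq_abs, abs_of_nonneg (Real.sqrt_nonneg l), mul_comm (√l)] at this
    rw [← this]
    simp_rw [real_inner_smul_left, real_inner_comm]
  have hgauss : Integrable fun ξ : EuclideanSpace ℝ (Fin d) => Real.exp (-‖ξ‖ ^ 2 / 4) := by
    have := integrable_norm_pow_mul_exp_neg h.dim_pos 0 (b := 1 / 4) (by norm_num)
    refine this.congr (ae_of_all _ fun ξ => ?_)
    simp only [pow_zero, one_mul]
    congr 1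
    ring
  rw [gaussianAverage]
  simp_rw [h1]
  rw [integral_integral_swap, ← integral_const_mul]
  · congr 1
    ext y
    have h2 : Integrable fun ξ : EuclideanSpace ℝ (Fin d) =>
        Real.exp (-‖ξ‖ ^ 2 / 4) * Real.cos (√l * inner ℝ y ξ) := by
      refine hgauss.mono' (by fun_prop) (ae_of_all _ fun ξ => ?_)
      rw [norm_mul, Real.norm_eq_abs, Real.abs_exp]
      exact mul_le_of_le_one_right (Real.exp_pos _).le (Real.abs_cos_le_one _)
    simp_rw [mul_sub, mul_one]
    rw [integral_sub hgauss h2, integral_exp_neg_mul_cos hl.le]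
    have h3 := integral_exp_neg_mul_cos (d := d) le_rfl (0 : EuclideanSpace ℝ (Fin d))
    simp only [inner_zero_left, mul_zero, Real.cos_zero, mul_one, zero_mul, neg_zero,
      Real.exp_zero] at h3
    rw [h3, neg_div, Real.rpow_neg (by positivity)]
    field_simp
  · refine ((hgauss.comp_fst (μ t)).const_mul 2).mono'
      (Continuous.aestronglyMeasurable (by unfold Function.uncurry; fun_prop))
      (ae_of_all _ fun z => ?_)
    simp only [Function.uncurry]
    rw [norm_mul, Real.norm_eq_abs, Real.abs_exp, mul_comm]
    gcongr
    rw [Real.norm_eq_abs, abs_le]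
    constructor <;> linarith [Real.cos_le_one (√l * inner ℝ z.2 z.1),
      Real.neg_one_le_cos (√l * inner ℝ z.2 z.1)]

lemma auxH_one_sub_exp (h : IsUnimodalSemigroup μ w ψ) (t : ℝ≥0) {l : ℝ} (hl : 0 < l) :
    auxH d (fun r => 1 - Real.exp (-(t * ψ r))) l = ∫ y, truncKernel (l * ‖y‖ ^ 2) ∂(μ t) := by
  have := h.prob t
  have hbd (u : ℝ) (hu : 0 ≤ u) : u * Real.exp (-u) ≤ 1 := by
    rw [Real.exp_neg, ← div_eq_mul_inv, div_le_one (Real.exp_pos _)]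
    linarith [Real.add_one_le_exp u]
  have h0 (u : ℝ) (hu : 0 ≤ u) : Integrable
      (fun y : EuclideanSpace ℝ (Fin d) => 1 - Real.exp (-(u * ‖y‖ ^ 2))) (μ t) := by
    refine Integrable.of_bound (C := 1) (by fun_prop) (ae_of_all _ fun y => ?_)
    have h1 : Real.exp (-(u * ‖y‖ ^ 2)) ≤ 1 := Real.exp_le_one_iff.mpr (by
      rw [neg_nonpos]; positivity)
    rw [Real.norm_eq_abs, abs_of_nonneg (by linarith)]
    linarith [Real.exp_pos (-(u * ‖y‖ ^ 2))]
  have hder := hasDerivAt_integral_of_dominated_loc_of_deriv_le (μ := μ t) (s := Ioo (l / 2) (2 * l))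
    (bound := fun _ => 2 / l)
    (F := fun u (y : EuclideanSpace ℝ (Fin d)) => 1 - Real.exp (-(u * ‖y‖ ^ 2)))
    (F' := fun u y => ‖y‖ ^ 2 * Real.exp (-(u * ‖y‖ ^ 2))) (x₀ := l)
    (Ioo_mem_nhds (by linarith) (by linarith)) (Eventually.of_forall fun u => by fun_prop)
    (h0 l hl.le) (by fun_prop) (ae_of_all _ fun y u hu => by
      have hu0 : 0 < u := by linarith [hu.1]
      rw [Real.norm_eq_abs, abs_of_nonneg (by positivity)]
      have h1 := hbd (u * ‖y‖ ^ 2) (by positivity)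
      have h2 : 1 / u ≤ 2 / l := by
        rw [div_le_div_iff₀ hu0 hl]
        linarith [hu.1]
      refine le_trans ?_ h2
      rw [le_div_iff₀ hu0]
      linarith) (integrable_const _) (ae_of_all _ fun y u hu => by
      have h1 : HasDerivAt (fun u : ℝ => -(u * ‖y‖ ^ 2)) (-(1 * ‖y‖ ^ 2)) u :=
        ((hasDerivAt_id u).mul_const _).neg
      convert! h1.exp.const_sub 1 using 1
      ring)
  have heq : gaussianAverage d (fun r => 1 - Real.exp (-(t * ψ r))) =ᶠ[𝓝 l]
      fun u => ∫ y, (1 - Real.exp (-(u * ‖y‖ ^ 2))) ∂(μ t) := by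
    filter_upwards [lt_mem_nhds hl] with u hu
    exact h.gaussianAverage_one_sub_exp t hu
  rw [auxH, heq.deriv_eq, hder.2.deriv, h.gaussianAverage_one_sub_exp t hl, ← integral_const_mul,
    ← integral_sub (h0 l hl.le) (hder.1.const_mul l)]
  congr 1
  ext y
  simp only [truncKernel]
  ring

lemma psi_growth (h : IsUnimodalSemigroup μ w ψ) {r : ℝ} (hr : 0 ≤ r) :
    |ψ r| ≤ ((2 + Real.pi ^ 2 / 4) * ψ 1) * (1 + r ^ 2) := by
  have h1 := h.psi_mul_le hr zero_le_one
  have h2 := h.psi_nonneg zero_le_one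
  rw [mul_one] at h1
  rw [abs_of_nonneg (h.psi_nonneg hr)]
  refine h1.trans ?_
  have h3 : 2 + Real.pi ^ 2 * r ^ 2 / 4 ≤ (2 + Real.pi ^ 2 / 4) * (1 + r ^ 2) := by
    nlinarith [sq_nonneg r, sq_nonneg Real.pi]
  nlinarith

/-- For small `t` the truncated second moment of `μ t` is `t H`, up to `O(t² ψ²)`. -/
lemma exists_abs_integral_truncKernel_sub_le (h : IsUnimodalSemigroup μ w ψ) :
    ∃ C : ℝ, ∀ (t : ℝ≥0) (l : ℝ), 0 < l →
      |∫ y, truncKernel (l * ‖y‖ ^ 2) ∂(μ t) - t * auxH d ψ l| ≤ C * (t * ψ √l) ^ 2 := by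
  set c := (4 * Real.pi) ^ (-(d : ℝ) / 2) with hc
  have hc0 : 0 ≤ c := by positivity
  -- This majorant combines the weight of `auxH_eq_integral` in absolute value with the square of
  -- the growth factor from `psi_mul_le`, so the constant does not depend on `t` or `l`.
  set G := fun ξ : EuclideanSpace ℝ (Fin d) => Real.exp (-(1 / 4) * ‖ξ‖ ^ 2) *
    ((1 + d / 2 + ‖ξ‖ ^ 2 / 4) * (2 + Real.pi ^ 2 * ‖ξ‖ ^ 2 / 4) ^ 2) with hG
  have hGi : Integrable G := by
    refine integrable_exp_neg_mul_of_growth h.dim_pos (by norm_num) (by fun_prop) (k := 3)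
      (C := (1 + d / 2) * (2 + Real.pi ^ 2 / 4) ^ 2) fun ξ => ?_
    rw [abs_of_nonneg (by positivity)]
    have h1 : 1 + (d : ℝ) / 2 + ‖ξ‖ ^ 2 / 4 ≤ (1 + d / 2) * (1 + ‖ξ‖ ^ 2) := by
      have : 0 ≤ (d : ℝ) / 2 * ‖ξ‖ ^ 2 := by positivity
      nlinarith [sq_nonneg ‖ξ‖]
    have h2 : 2 + Real.pi ^ 2 * ‖ξ‖ ^ 2 / 4 ≤ (2 + Real.pi ^ 2 / 4) * (1 + ‖ξ‖ ^ 2) := by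
      nlinarith [sq_nonneg ‖ξ‖, sq_nonneg Real.pi]
    calc _ ≤ ((1 + d / 2) * (1 + ‖ξ‖ ^ 2)) * ((2 + Real.pi ^ 2 / 4) * (1 + ‖ξ‖ ^ 2)) ^ 2 := by gcongr
      _ = _ := by ring
  refine ⟨c * ∫ ξ, G ξ, fun t l hl => ?_⟩
  have hψn (r : ℝ) : 0 ≤ t * ψ |r| := mul_nonneg t.2 (h.psi_nonneg (abs_nonneg r))
  have hfc : Continuous fun r : ℝ => 1 - Real.exp (-(t * ψ |r|)) := by
    exact continuous_const.sub
      (Real.continuous_exp.comp (continuous_const.mul h.continuous_psi_abs).neg)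
  have hfb (r : ℝ) (hr : 0 ≤ r) : |1 - Real.exp (-(t * ψ r))| ≤ 1 * (1 + r ^ 2) := by
    have h1 := hψn r
    rw [abs_of_nonneg hr] at h1
    have h2 : Real.exp (-(t * ψ r)) ≤ 1 := Real.exp_le_one_iff.mpr (by linarith)
    rw [abs_of_nonneg (by linarith)]
    nlinarith [Real.exp_pos (-(t * ψ r))]
  have hexp (ξ : EuclideanSpace ℝ (Fin d)) :
      Real.exp (-‖ξ‖ ^ 2 / 4) = Real.exp (-(1 / 4) * ‖ξ‖ ^ 2) := by
    congr 1
    ring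
  have hcont {f : ℝ → ℝ} (hf : Continuous fun r => f |r|) :
      Continuous fun ξ : EuclideanSpace ℝ (Fin d) => f (‖ξ‖ * √l) := by
    have := hf.comp ((continuous_norm (E := EuclideanSpace ℝ (Fin d))).mul_const √l)
    simpa only [Function.comp_def, abs_mul, abs_norm, abs_of_nonneg (Real.sqrt_nonneg l)] using this
  have hint {f : ℝ → ℝ} (hf : Continuous fun r => f |r|) {C : ℝ} (hC0 : 0 ≤ C)
      (hC : ∀ r, 0 ≤ r → |f r| ≤ C * (1 + r ^ 2)) :
      Integrable fun ξ : EuclideanSpace ℝ (Fin d) =>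
        Real.exp (-‖ξ‖ ^ 2 / 4) * ((1 + d / 2 - ‖ξ‖ ^ 2 / 4) * f (‖ξ‖ * √l)) := by
    simp_rw [hexp]
    refine integrable_exp_neg_mul_of_growth h.dim_pos (by norm_num)
      (Continuous.mul (by fun_prop) (hcont hf)) (k := 2) (C := (1 + d / 2) * (C * (1 + l)))
      fun ξ => ?_
    have h1 := hC (‖ξ‖ * √l) (by positivity)
    rw [mul_pow, Real.sq_sqrt hl.le] at h1
    have h2 : 1 + ‖ξ‖ ^ 2 * l ≤ (1 + l) * (1 + ‖ξ‖ ^ 2) := by nlinarith [sq_nonneg ‖ξ‖]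
    have h3 : |1 + (d : ℝ) / 2 - ‖ξ‖ ^ 2 / 4| ≤ (1 + d / 2) * (1 + ‖ξ‖ ^ 2) := by
      have h4 : 0 ≤ (d : ℝ) / 2 := by positivity
      have h5 : 0 ≤ (d : ℝ) / 2 * ‖ξ‖ ^ 2 := by positivity
      rw [abs_le]
      constructor <;> nlinarith [sq_nonneg ‖ξ‖]
    rw [abs_mul]
    calc _ ≤ ((1 + d / 2) * (1 + ‖ξ‖ ^ 2)) * (C * ((1 + l) * (1 + ‖ξ‖ ^ 2))) := by
          gcongr
          exact h1.trans (by gcongr)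
      _ = _ := by ring
  have hψ1 : 0 ≤ (2 + Real.pi ^ 2 / 4) * ψ 1 := by
    have := h.psi_nonneg zero_le_one
    positivity
  rw [← h.auxH_one_sub_exp t hl, auxH_eq_integral h.dim_pos hfc hfb hl,
    auxH_eq_integral h.dim_pos h.continuous_psi_abs (fun r hr => h.psi_growth hr) hl,
    mul_left_comm, ← mul_sub, ← integral_const_mul, ← integral_sub (hint hfc zero_le_one hfb)
    ((hint h.continuous_psi_abs hψ1 (fun r hr => h.psi_growth hr)).const_mul _), abs_mul,
    abs_of_nonneg hc0, mul_assoc, ← integral_mul_const]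
  gcongr
  rw [← Real.norm_eq_abs]
  refine norm_integral_le_of_norm_le (hGi.mul_const _) (ae_of_all _ fun ξ => ?_)
  set a := t * ψ (‖ξ‖ * √l) with ha
  have ha0 : 0 ≤ a := by
    have := hψn (‖ξ‖ * √l)
    rwa [abs_of_nonneg (by positivity)] at this
  have hale : a ≤ (2 + Real.pi ^ 2 * ‖ξ‖ ^ 2 / 4) * (t * ψ √l) := by
    have h1 := mul_le_mul_of_nonneg_left
      (h.psi_mul_le (norm_nonneg ξ) (Real.sqrt_nonneg l)) t.2
    refine h1.trans (le_of_eq ?_)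
    change (t : ℝ) * _ = _
    ring
  have hquad : |1 - Real.exp (-a) - a| ≤ a ^ 2 := by
    have h4 := Real.add_one_le_exp a
    have h5 := Real.add_one_le_exp (-a)
    have h6 : Real.exp (-a) ≤ 1 - a + a ^ 2 := by
      rw [Real.exp_neg]
      refine (inv_anti₀ (by linarith) h4).trans ?_
      rw [inv_le_iff_one_le_mul₀ (by linarith)]
      nlinarith [pow_nonneg ha0 3]
    rw [abs_le]
    constructor <;> nlinarith
  have h7 : Real.exp (-‖ξ‖ ^ 2 / 4) * ((1 + d / 2 - ‖ξ‖ ^ 2 / 4) * (1 - Real.exp (-a)))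
      - t * (Real.exp (-‖ξ‖ ^ 2 / 4) * ((1 + d / 2 - ‖ξ‖ ^ 2 / 4) * ψ (‖ξ‖ * √l)))
      = Real.exp (-(1 / 4) * ‖ξ‖ ^ 2) * ((1 + d / 2 - ‖ξ‖ ^ 2 / 4) * (1 - Real.exp (-a) - a)) := by
    rw [hexp, ha]
    ring
  rw [h7, norm_mul, norm_mul, Real.norm_eq_abs, Real.abs_exp, Real.norm_eq_abs, Real.norm_eq_abs,
    hG]
  simp only [mul_assoc]
  gcongr
  · rw [abs_le]
    have : 0 ≤ (d : ℝ) / 2 := by positivity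
    constructor <;> nlinarith [sq_nonneg ‖ξ‖]
  · refine hquad.trans ?_
    rw [← mul_pow]
    gcongr

end IsUnimodalSemigroup

/-! ### A Tauberian theorem of Karamata type. -/

section Karamata

lemma continuous_truncKernel : Continuous truncKernel := by
  unfold truncKernel
  fun_prop

lemma hasDerivAt_truncKernel (u : ℝ) : HasDerivAt truncKernel (u * Real.exp (-u)) u := by
  have h1 : HasDerivAt (fun u : ℝ => Real.exp (-u)) (-Real.exp (-u)) u := by
    simpa using (hasDerivAt_neg u).exp
  convert! (h1.const_sub 1).sub ((hasDerivAt_id u).mul h1) using 1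
  simp

/-- The kernel has derivative `u e^{-u}`; freezing the exponential at an endpoint leaves a
difference of squares. With `le_truncKernel_sub` this brackets second-moment Laplace transforms by
kernel differences. -/
lemma truncKernel_sub_le {x y : ℝ} (hx : 0 ≤ x) (hxy : x ≤ y) :
    truncKernel y - truncKernel x ≤ (y ^ 2 - x ^ 2) / 2 * Real.exp (-x) := by
  have hd (u : ℝ) : HasDerivAt (fun v => truncKernel v - v ^ 2 / 2 * Real.exp (-x))
      (u * Real.exp (-u) - u * Real.exp (-x)) u := by
    convert! (hasDerivAt_truncKernel u).sub (((hasDerivAt_pow 2 u).div_const 2).mul_const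
      (Real.exp (-x))) using 1
    simp
  have hanti : AntitoneOn (fun v => truncKernel v - v ^ 2 / 2 * Real.exp (-x)) (Ici x) := by
    refine antitoneOn_of_deriv_nonpos (convex_Ici x)
      (fun u _ => (hd u).continuousAt.continuousWithinAt)
      (fun u _ => (hd u).differentiableAt.differentiableWithinAt) fun u hu => ?_
    rw [interior_Ici, mem_Ioi] at hu
    rw [(hd u).deriv, ← mul_sub]
    have : Real.exp (-u) ≤ Real.exp (-x) := Real.exp_le_exp.mpr (by linarith)
    exact mul_nonpos_of_nonneg_of_nonpos (by linarith) (by linarith)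
  have := hanti self_mem_Ici hxy hxy
  simp only at this
  linarith

lemma le_truncKernel_sub {x y : ℝ} (hx : 0 ≤ x) (hxy : x ≤ y) :
    (y ^ 2 - x ^ 2) / 2 * Real.exp (-y) ≤ truncKernel y - truncKernel x := by
  have hd (u : ℝ) : HasDerivAt (fun v => truncKernel v - v ^ 2 / 2 * Real.exp (-y))
      (u * Real.exp (-u) - u * Real.exp (-y)) u := by
    convert! (hasDerivAt_truncKernel u).sub (((hasDerivAt_pow 2 u).div_const 2).mul_const
      (Real.exp (-y))) using 1
    simp
  have hmono : MonotoneOn (fun v => truncKernel v - v ^ 2 / 2 * Real.exp (-y)) (Icc x y) := by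
    refine monotoneOn_of_deriv_nonneg (convex_Icc x y)
      (fun u _ => (hd u).continuousAt.continuousWithinAt)
      (fun u _ => (hd u).differentiableAt.differentiableWithinAt) fun u hu => ?_
    rw [interior_Icc, mem_Ioo] at hu
    rw [(hd u).deriv, ← mul_sub]
    have : Real.exp (-y) ≤ Real.exp (-u) := Real.exp_le_exp.mpr (by linarith)
    exact mul_nonneg (by linarith) (by linarith)
  have := hmono (left_mem_Icc.mpr hxy) (right_mem_Icc.mpr hxy) hxy
  simp only at this
  linarith

lemma truncKernel_nonneg {u : ℝ} (hu : 0 ≤ u) : 0 ≤ truncKernel u := by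
  have h1 := le_truncKernel_sub le_rfl hu
  have h2 : truncKernel 0 = 0 := by simp [truncKernel]
  have h3 : 0 ≤ (u ^ 2 - 0 ^ 2) / 2 * Real.exp (-u) := by
    rw [zero_pow two_ne_zero, sub_zero]
    positivity
  linarith

lemma truncKernel_le_one {u : ℝ} (hu : 0 ≤ u) : truncKernel u ≤ 1 := by
  have := Real.exp_pos (-u)
  unfold truncKernel
  nlinarith

lemma sq_mul_exp_neg_le {u : ℝ} (hu : 0 ≤ u) : u ^ 2 * Real.exp (-u) ≤ 2 := by
  have h := Real.quadratic_le_exp_of_nonneg hu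
  rw [Real.exp_neg, ← div_eq_mul_inv, div_le_iff₀ (Real.exp_pos _)]
  nlinarith

lemma tendsto_rpow_sub_div_sq_sub {c : ℝ} (hc : 0 < c) (γ : ℝ) :
    Tendsto (fun b : ℝ => (b ^ γ - c ^ γ) / ((b ^ 2 - c ^ 2) / 2)) (𝓝[≠] c)
      (𝓝 (γ * c ^ (γ - 2))) := by
  have h1 := hasDerivAt_iff_tendsto_slope.mp
    (Real.hasDerivAt_rpow_const (x := c) (p := γ) (Or.inl hc.ne'))
  have h2 : Tendsto (fun b : ℝ => 2 / (b + c)) (𝓝[≠] c) (𝓝 (2 / (c + c))) := by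
    have : ContinuousAt (fun b : ℝ => 2 / (b + c)) c := by fun_prop (disch := positivity)
    exact this.tendsto.mono_left nhdsWithin_le_nhds
  have h3 := h1.mul h2
  have h4 : γ * c ^ (γ - 1) * (2 / (c + c)) = γ * c ^ (γ - 2) := by
    rw [show γ - 1 = γ - 2 + 1 by ring, Real.rpow_add_one hc.ne']
    field_simp
    ring
  rw [h4] at h3
  refine h3.congr' ?_
  filter_upwards [self_mem_nhdsWithin, nhdsWithin_le_nhds (lt_mem_nhds hc)] with b hb hb0
  have h5 : b - c ≠ 0 := sub_ne_zero.mpr hb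
  have h6 : b + c ≠ 0 := by positivity
  rw [slope_def_field, show b ^ 2 - c ^ 2 = (b - c) * (b + c) by ring]
  field_simp

/-- Weierstrass approximation on `[0,1]`; the zeroth moment keeps the total masses bounded. -/
lemma tendsto_integral_of_tendsto_moments {ι α : Type*} [MeasurableSpace α] {l : Filter ι}
    {σ : ι → Measure α} {τ : Measure α} [∀ i, IsFiniteMeasure (σ i)] [IsFiniteMeasure τ]
    {v : α → ℝ} (hv : Measurable v) (hσ : ∀ i, ∀ᵐ a ∂σ i, v a ∈ Icc (0 : ℝ) 1)
    (hτ : ∀ᵐ a ∂τ, v a ∈ Icc (0 : ℝ) 1)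
    (hmom : ∀ n : ℕ, Tendsto (fun i => ∫ a, v a ^ n ∂σ i) l (𝓝 (∫ a, v a ^ n ∂τ)))
    {f : ℝ → ℝ} (hf : Continuous f) :
    Tendsto (fun i => ∫ a, f (v a) ∂σ i) l (𝓝 (∫ a, f (v a) ∂τ)) := by
  have hint {g : ℝ → ℝ} (hg : Continuous g) (κ : Measure α) [IsFiniteMeasure κ]
      (hκ : ∀ᵐ a ∂κ, v a ∈ Icc (0 : ℝ) 1) : Integrable (fun a => g (v a)) κ := by
    obtain ⟨C, hC⟩ := isCompact_Icc.exists_bound_of_continuousOn (s := Icc (0 : ℝ) 1) hg.continuousOn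
    refine Integrable.of_bound (C := C) (hg.measurable.comp hv).aestronglyMeasurable ?_
    filter_upwards [hκ] with a ha using hC _ ha
  have hpoly (p : Polynomial ℝ) :
      Tendsto (fun i => ∫ a, p.eval (v a) ∂σ i) l (𝓝 (∫ a, p.eval (v a) ∂τ)) := by
    induction p using Polynomial.induction_on' with
    | add p q hp hq =>
      simp only [Polynomial.eval_add]
      rw [integral_add (hint p.continuous τ hτ) (hint q.continuous τ hτ)]
      refine (hp.add hq).congr fun i => ?_
      rw [integral_add (hint p.continuous _ (hσ i)) (hint q.continuous _ (hσ i))]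
    | monomial n a =>
      simp only [Polynomial.eval_monomial, integral_const_mul]
      exact (hmom n).const_mul a
  have hmass : Tendsto (fun i => (σ i).real univ) l (𝓝 (τ.real univ)) := by
    simpa using hmom 0
  rw [Metric.tendsto_nhds]
  intro ε hε
  set m := τ.real univ with hm
  have hm0 : 0 ≤ m := measureReal_nonneg
  -- Chosen so that `δ(m+1) + δm = ε/2`, the masses being eventually below `m + 1`.
  set δ := ε / (2 * (2 * m + 1)) with hδ
  have hδ0 : 0 < δ := by positivity
  obtain ⟨p, hp⟩ := exists_polynomial_near_of_continuousOn 0 1 f hf.continuousOn δ hδ0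
  have hclose (κ : Measure α) [IsFiniteMeasure κ] (hκ : ∀ᵐ a ∂κ, v a ∈ Icc (0 : ℝ) 1) :
      |∫ a, p.eval (v a) ∂κ - ∫ a, f (v a) ∂κ| ≤ δ * κ.real univ := by
    rw [← integral_sub (hint p.continuous κ hκ) (hint hf κ hκ), ← Real.norm_eq_abs]
    refine norm_integral_le_of_norm_le_const ?_
    filter_upwards [hκ] with a ha using (hp _ ha).le
  filter_upwards [Metric.tendsto_nhds.mp (hpoly p) (ε / 2) (by positivity),
    hmass.eventually (gt_mem_nhds (lt_add_one m))] with i hi1 hi2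
  rw [Real.dist_eq] at hi1 ⊢
  have h1 := hclose (σ i) (hσ i)
  have h2 := hclose τ hτ
  have h3 : δ * (σ i).real univ ≤ δ * (m + 1) := by gcongr
  have h4 : δ * (m + 1) + δ * m = ε / 2 := by
    rw [hδ]
    field_simp
    ring
  rw [abs_le] at h1 h2
  rw [abs_lt] at hi1 ⊢
  constructor <;> linarith [h1.1, h1.2, h2.1, h2.2, hi1.1, hi1.2]

variable {ι : Type*} {l : Filter ι} {ρ : ι → Measure ℝ} [∀ i, IsFiniteMeasure (ρ i)] {γ : ℝ}

/-- The divided difference of the transform between `b` and `c`, taken in the variable `c²/2`,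
bounds the integral from above for `b < c` and from below for `b > c`. Its limit along `l` is that
of `c^γ`, and `b → c` closes the gap. -/
lemma tendsto_integral_sq_mul_exp (hρ : ∀ i, ∀ᵐ u ∂ρ i, 0 ≤ u)
    (hk : ∀ c : ℝ, 0 < c → Tendsto (fun i => ∫ u, truncKernel (c * u) ∂ρ i) l (𝓝 (c ^ γ)))
    {c : ℝ} (hc : 0 < c) :
    Tendsto (fun i => ∫ u, u ^ 2 * Real.exp (-(c * u)) ∂ρ i) l (𝓝 (γ * c ^ (γ - 2))) := by
  have hik (b : ℝ) (hb : 0 < b) (i : ι) : Integrable (fun u => truncKernel (b * u)) (ρ i) := by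
    refine Integrable.of_bound (C := 1)
      (continuous_truncKernel.comp (by fun_prop)).aestronglyMeasurable ?_
    filter_upwards [hρ i] with u hu
    have : 0 ≤ b * u := by positivity
    rw [Real.norm_eq_abs, abs_of_nonneg (truncKernel_nonneg this)]
    exact truncKernel_le_one this
  have hie (i : ι) : Integrable (fun u => u ^ 2 * Real.exp (-(c * u))) (ρ i) := by
    refine Integrable.of_bound (C := 2 / c ^ 2) (by fun_prop) ?_
    filter_upwards [hρ i] with u hu
    rw [Real.norm_eq_abs, abs_of_nonneg (by positivity), le_div_iff₀ (by positivity)]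
    have := sq_mul_exp_neg_le (u := c * u) (by positivity)
    linarith
  have hlim (b : ℝ) (hb : 0 < b) : Tendsto (fun i => (∫ u, truncKernel (b * u) ∂ρ i
      - ∫ u, truncKernel (c * u) ∂ρ i) / ((b ^ 2 - c ^ 2) / 2)) l
      (𝓝 ((b ^ γ - c ^ γ) / ((b ^ 2 - c ^ 2) / 2))) :=
    ((hk b hb).sub (hk c hc)).div_const _
  have hslope := tendsto_rpow_sub_div_sq_sub hc γ
  have hup (b : ℝ) (hb : 0 < b) (hbc : b < c) (i : ι) :
      ∫ u, u ^ 2 * Real.exp (-(c * u)) ∂ρ i ≤ (∫ u, truncKernel (b * u) ∂ρ i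
      - ∫ u, truncKernel (c * u) ∂ρ i) / ((b ^ 2 - c ^ 2) / 2) := by
    rw [le_div_iff_of_neg (by nlinarith), ← integral_sub (hik b hb i) (hik c hc i),
      ← integral_mul_const]
    refine integral_mono_ae ((hik b hb i).sub (hik c hc i)) ((hie i).mul_const _) ?_
    filter_upwards [hρ i] with u hu
    have := le_truncKernel_sub (x := b * u) (y := c * u) (by positivity) (by gcongr)
    nlinarith
  have hlo (b : ℝ) (hbc : c < b) (i : ι) :
      (∫ u, truncKernel (b * u) ∂ρ i - ∫ u, truncKernel (c * u) ∂ρ i) / ((b ^ 2 - c ^ 2) / 2)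
      ≤ ∫ u, u ^ 2 * Real.exp (-(c * u)) ∂ρ i := by
    have hb := hc.trans hbc
    rw [div_le_iff₀ (by nlinarith), ← integral_sub (hik b hb i) (hik c hc i),
      ← integral_mul_const]
    refine integral_mono_ae ((hik b hb i).sub (hik c hc i)) ((hie i).mul_const _) ?_
    filter_upwards [hρ i] with u hu
    have := truncKernel_sub_le (x := c * u) (y := b * u) (by positivity) (by gcongr)
    nlinarith
  rw [tendsto_order]
  constructor
  · intro x hx
    have h1 := (hslope.mono_left (nhdsWithin_mono c (s := Ioi c) fun b hb => ne_of_gt hb)).eventually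
      (lt_mem_nhds hx)
    obtain ⟨b, hb1, hb2⟩ := (h1.and self_mem_nhdsWithin).exists
    filter_upwards [(hlim b (hc.trans hb2)).eventually (lt_mem_nhds hb1)] with i hi
    exact hi.trans_le (hlo b hb2 i)
  · intro x hx
    have h1 := (hslope.mono_left (nhdsWithin_mono c (s := Iio c) fun b hb => ne_of_lt hb)).eventually
      (gt_mem_nhds hx)
    obtain ⟨b, ⟨hb1, hb2⟩, hb3⟩ := ((h1.and self_mem_nhdsWithin).and
      (nhdsWithin_le_nhds (lt_mem_nhds hc))).exists
    filter_upwards [(hlim b hb3).eventually (gt_mem_nhds hb1)] with i hi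
    exact (hup b hb3 hb2 i).trans_lt hi

/-- Karamata's Tauberian theorem for the kernel `1 - e^{-u} - u e^{-u}`. -/
lemma tendsto_integral_comp_exp_neg (hγ : 0 ≤ γ) (hγ2 : γ < 2) (hρ : ∀ i, ∀ᵐ u ∂ρ i, 0 ≤ u)
    (hk : ∀ c : ℝ, 0 < c → Tendsto (fun i => ∫ u, truncKernel (c * u) ∂ρ i) l (𝓝 (c ^ γ)))
    {f : ℝ → ℝ} (hf : Continuous f) :
    Tendsto (fun i => ∫ u, u ^ 2 * Real.exp (-u) * f (Real.exp (-u)) ∂ρ i) l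
      (𝓝 (γ / Real.Gamma (2 - γ) *
        ∫ u in Ioi 0, u ^ (1 - γ) * Real.exp (-u) * f (Real.exp (-u)))) := by
  have hG : 0 < Real.Gamma (2 - γ) := Real.Gamma_pos_of_pos (by linarith)
  set B := γ / Real.Gamma (2 - γ) with hB
  have hB0 : 0 ≤ B := by positivity
  -- The weight `u² e^{-u}` damps mass near `0`, where no uniform bound on `ρ i` is available; the
  -- weighted limit `τ` is finite because `γ < 2`.
  set σ : ι → Measure ℝ := fun i =>
    (ρ i).withDensity fun u => ENNReal.ofReal (u ^ 2 * Real.exp (-u)) with hσ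
  set τ : Measure ℝ := (volume.restrict (Ioi 0)).withDensity
    fun u => ENNReal.ofReal (B * (u ^ (1 - γ) * Real.exp (-u))) with hτ
  have hmom0 : IntegrableOn (fun u : ℝ => u ^ (1 - γ) * Real.exp (-u)) (Ioi 0) := by
    have := Real.GammaIntegral_convergent (s := 2 - γ) (by linarith)
    refine this.congr_fun (fun u _ => ?_) measurableSet_Ioi
    simp only
    rw [mul_comm, show 2 - γ - 1 = 1 - γ by ring]
  have hσfin (i : ι) : IsFiniteMeasure (σ i) := by
    refine isFiniteMeasure_withDensity_ofReal (Integrable.hasFiniteIntegral ?_)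
    refine Integrable.of_bound (C := 2) (by fun_prop) ?_
    filter_upwards [hρ i] with u hu
    rw [Real.norm_eq_abs, abs_of_nonneg (by positivity)]
    exact sq_mul_exp_neg_le hu
  have hτfin : IsFiniteMeasure τ :=
    isFiniteMeasure_withDensity_ofReal (hmom0.const_mul B).hasFiniteIntegral
  have hσint (g : ℝ → ℝ) (i : ι) :
      ∫ u, g u ∂σ i = ∫ u, u ^ 2 * Real.exp (-u) * g u ∂ρ i := by
    rw [hσ, integral_withDensity_eq_integral_toReal_smul₀ (by fun_prop)
      (ae_of_all _ fun u => ENNReal.ofReal_lt_top)]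
    refine integral_congr_ae (ae_of_all _ fun u => ?_)
    simp only [smul_eq_mul]
    rw [ENNReal.toReal_ofReal (by positivity)]
  have hτint (g : ℝ → ℝ) :
      ∫ u, g u ∂τ = B * ∫ u in Ioi 0, u ^ (1 - γ) * Real.exp (-u) * g u := by
    rw [hτ, integral_withDensity_eq_integral_toReal_smul₀ (by fun_prop)
      (ae_of_all _ fun u => ENNReal.ofReal_lt_top), ← integral_const_mul]
    refine setIntegral_congr_fun measurableSet_Ioi fun u hu => ?_
    have hu' : (0 : ℝ) ≤ u := le_of_lt hu
    simp only [smul_eq_mul]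
    rw [ENNReal.toReal_ofReal (by positivity)]
    ring
  have hv (u : ℝ) (hu : 0 ≤ u) : Real.exp (-u) ∈ Icc (0 : ℝ) 1 :=
    ⟨(Real.exp_pos _).le, Real.exp_le_one_iff.mpr (by linarith)⟩
  have key := tendsto_integral_of_tendsto_moments (l := l) (σ := σ) (τ := τ)
    (v := fun u : ℝ => Real.exp (-u)) (by fun_prop)
    (fun i => (withDensity_absolutelyContinuous _ _).ae_le
      ((hρ i).mono fun u hu => hv u hu))
    ((withDensity_absolutelyContinuous _ _).ae_le
      ((ae_restrict_mem measurableSet_Ioi).mono fun u (hu : 0 < u) => hv u hu.le))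
    (fun n => ?_) hf
  · simpa only [hσint, hτint] using key
  · simp only [hσint, hτint]
    -- The `n`-th moment of `e^{-u}` under `σ i` is the transform at `n + 1`, one unit coming from
    -- the weight.
    have h1 := tendsto_integral_sq_mul_exp hρ hk (c := n + 1) (by positivity)
    have h2 (u : ℝ) : Real.exp (-u) * Real.exp (-u) ^ n = Real.exp (-((n + 1) * u)) := by
      rw [← Real.exp_nat_mul, ← Real.exp_add]
      congr 1
      ring
    simp only [mul_assoc, h2]
    have h3 := Real.integral_rpow_mul_exp_neg_mul_Ioi (a := 2 - γ) (r := n + 1) (by linarith)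
      (by positivity)
    rw [show 2 - γ - 1 = 1 - γ by ring] at h3
    rw [h3]
    convert! h1 using 2
    rw [hB, one_div, Real.inv_rpow (by positivity), ← Real.rpow_neg (by positivity), neg_sub]
    field_simp

end Karamata

/-! ### Test bumps and radial integration. -/

/-- A continuous bump function, positive exactly on the interval `(a, b)` when `0 < a`. -/
noncomputable def expBump (a b u : ℝ) : ℝ :=
  u ^ 2 * Real.exp (-u) *
    max 0 ((Real.exp (-u) - Real.exp (-b)) * (Real.exp (-a) - Real.exp (-u)))

section ExpBump

variable {a b : ℝ}

lemma continuous_expBump : Continuous (expBump a b) := by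
  unfold expBump
  fun_prop

lemma expBump_nonneg (u : ℝ) : 0 ≤ expBump a b u := by
  unfold expBump
  positivity

lemma expBump_pos (ha : 0 < a) {u : ℝ} (hu : u ∈ Ioo a b) : 0 < expBump a b u := by
  have h1 : Real.exp (-b) < Real.exp (-u) := Real.exp_lt_exp.mpr (by linarith [hu.2])
  have h2 : Real.exp (-u) < Real.exp (-a) := Real.exp_lt_exp.mpr (by linarith [hu.1])
  have h3 : 0 < u := ha.trans hu.1
  have h4 := mul_pos (sub_pos.mpr h1) (sub_pos.mpr h2)
  exact mul_pos (by positivity) (lt_max_of_lt_right h4)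

lemma mem_Ioo_of_expBump_ne_zero (hab : a ≤ b) {u : ℝ} (hu : expBump a b u ≠ 0) : u ∈ Ioo a b := by
  have h1 : Real.exp (-b) ≤ Real.exp (-a) := Real.exp_le_exp.mpr (by linarith)
  by_contra hcon
  apply hu
  have h2 : (Real.exp (-u) - Real.exp (-b)) * (Real.exp (-a) - Real.exp (-u)) ≤ 0 := by
    rcases le_or_gt u a with h | h
    · have : Real.exp (-a) ≤ Real.exp (-u) := Real.exp_le_exp.mpr (by linarith)
      exact mul_nonpos_of_nonneg_of_nonpos (by linarith) (by linarith)
    · have hbu : b ≤ u := not_lt.mp fun hub => hcon ⟨h, hub⟩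
      have : Real.exp (-u) ≤ Real.exp (-b) := Real.exp_le_exp.mpr (by linarith)
      exact mul_nonpos_of_nonpos_of_nonneg (by linarith) (by linarith)
  rw [expBump, max_eq_left h2, mul_zero]

lemma setIntegral_rpow_mul_expBump (ha : 0 < a) (hab : a ≤ b) (q : ℝ) :
    ∫ u in Ioi 0, u ^ q * expBump a b u = ∫ u in Icc a b, u ^ q * expBump a b u := by
  refine (setIntegral_eq_of_subset_of_forall_sdiff_eq_zero measurableSet_Ioi
    (fun u hu => ha.trans_le hu.1) fun u hu => ?_)
  by_contra hne
  exact hu.2 (Ioo_subset_Icc_self (mem_Ioo_of_expBump_ne_zero hab (right_ne_zero_of_mul hne)))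

lemma integrableOn_rpow_mul_expBump (ha : 0 < a) (q : ℝ) :
    IntegrableOn (fun u => u ^ q * expBump a b u) (Icc a b) := by
  refine ContinuousOn.integrableOn_Icc (ContinuousOn.mul ?_ continuous_expBump.continuousOn)
  exact continuousOn_id.rpow_const fun u hu => Or.inl (ha.trans_le hu.1).ne'

/-- On `[a, b]` the factor `u^{-θ}` lies between its endpoint values. This trades the limit density
for the Lebesgue one at a cost that disappears as the interval shrinks to `1`. -/
lemma rpow_mul_setIntegral_le (ha : 0 < a) (hab : a ≤ b) {θ : ℝ} (hθ : 0 ≤ θ) (q : ℝ) :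
    b ^ (-θ) * ∫ u in Ioi 0, u ^ q * expBump a b u
      ≤ ∫ u in Ioi 0, u ^ (q - θ) * expBump a b u := by
  rw [setIntegral_rpow_mul_expBump ha hab, setIntegral_rpow_mul_expBump ha hab,
    ← integral_const_mul]
  refine setIntegral_mono_on ((integrableOn_rpow_mul_expBump ha q).const_mul _)
    (integrableOn_rpow_mul_expBump ha _) measurableSet_Icc fun u hu => ?_
  have hu0 : 0 < u := ha.trans_le hu.1
  rw [← mul_assoc, sub_eq_add_neg, Real.rpow_add hu0, mul_comm (b ^ (-θ))]
  have := expBump_nonneg (a := a) (b := b) u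
  have h2 := Real.rpow_le_rpow_of_nonpos hu0 hu.2 (neg_nonpos.mpr hθ)
  gcongr

lemma setIntegral_le_rpow_mul (ha : 0 < a) (hab : a ≤ b) {θ : ℝ} (hθ : 0 ≤ θ) (q : ℝ) :
    ∫ u in Ioi 0, u ^ (q - θ) * expBump a b u
      ≤ a ^ (-θ) * ∫ u in Ioi 0, u ^ q * expBump a b u := by
  rw [setIntegral_rpow_mul_expBump ha hab, setIntegral_rpow_mul_expBump ha hab,
    ← integral_const_mul]
  refine setIntegral_mono_on (integrableOn_rpow_mul_expBump ha _)
    ((integrableOn_rpow_mul_expBump ha q).const_mul _) measurableSet_Icc fun u hu => ?_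
  have hu0 : 0 < u := ha.trans_le hu.1
  rw [← mul_assoc, sub_eq_add_neg, Real.rpow_add hu0, mul_comm (a ^ (-θ))]
  have := expBump_nonneg (a := a) (b := b) u
  have h2 := Real.rpow_le_rpow_of_nonpos ha hu.1 (neg_nonpos.mpr hθ)
  gcongr

end ExpBump

lemma integral_comp_norm_sq {d : ℕ} (hd : 0 < d) (g : ℝ → ℝ) :
    ∫ y : EuclideanSpace ℝ (Fin d), g (‖y‖ ^ 2) = Real.pi ^ ((d : ℝ) / 2) / Real.Gamma ((d : ℝ) / 2)
      * ∫ u in Ioi 0, u ^ ((d : ℝ) / 2 - 1) * g u := by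
  have : Nonempty (Fin d) := ⟨⟨0, hd⟩⟩
  have hd' : (0 : ℝ) < d := by exact_mod_cast hd
  have hG : 0 < Real.Gamma ((d : ℝ) / 2) := Real.Gamma_pos_of_pos (by positivity)
  rw [integral_fun_norm_addHaar volume (fun r => g (r ^ 2)), finrank_euclideanSpace_fin,
    ← integral_comp_rpow_Ioi_of_pos (g := fun u => u ^ ((d : ℝ) / 2 - 1) * g u) (p := 2) (by norm_num)]
  have h1 : ∫ x in Ioi (0 : ℝ), (2 * x ^ ((2 : ℝ) - 1)) •
      ((x ^ (2 : ℝ)) ^ ((d : ℝ) / 2 - 1) * g (x ^ (2 : ℝ)))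
      = 2 * ∫ y in Ioi (0 : ℝ), y ^ (d - 1) • g (y ^ 2) := by
    rw [← integral_const_mul]
    refine setIntegral_congr_fun measurableSet_Ioi fun x (hx : 0 < x) => ?_
    have h2 : x ^ (d - 1) = x ^ ((2 : ℝ) - 1) * (x ^ (2 : ℝ)) ^ ((d : ℝ) / 2 - 1) := by
      rw [← Real.rpow_mul hx.le, ← Real.rpow_add hx, ← Real.rpow_natCast, Nat.cast_sub hd]
      congr 1
      push_cast
      ring
    simp only [smul_eq_mul]
    rw [h2, ← Real.rpow_natCast x 2]
    push_cast
    ring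
  have hvol : (volume : Measure (EuclideanSpace ℝ (Fin d))).real (Metric.ball 0 1)
      = Real.pi ^ ((d : ℝ) / 2) / Real.Gamma ((d : ℝ) / 2 + 1) := by
    have hG1 : 0 < Real.Gamma ((d : ℝ) / 2 + 1) := Real.Gamma_pos_of_pos (by positivity)
    rw [Measure.real, EuclideanSpace.volume_ball, Fintype.card_fin, ENNReal.ofReal_one, one_pow,
      one_mul, ENNReal.toReal_ofReal (by positivity), Real.sqrt_eq_rpow, ← Real.rpow_natCast,
      ← Real.rpow_mul Real.pi_pos.le]
    congr 2
    ring
  rw [h1, hvol, Real.Gamma_add_one (by positivity), nsmul_eq_mul, smul_eq_mul]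
  field_simp

/-! ### Comparing bump integrals with the density at a point. -/

namespace IsUnimodalMeasure

variable {d : ℕ} {μ : Measure (EuclideanSpace ℝ (Fin d))}
  {w : EuclideanSpace ℝ (Fin d) → ℝ≥0∞} {a b : ℝ}

lemma hasCompactSupport_expBump (hab : a ≤ b) {s : ℝ} (hs : 0 < s) :
    HasCompactSupport fun y : EuclideanSpace ℝ (Fin d) => expBump a b (s * ‖y‖ ^ 2) := by
  refine HasCompactSupport.of_support_subset_isCompact
    (isCompact_closedBall (0 : EuclideanSpace ℝ (Fin d)) √(b / s)) fun y hy => ?_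
  have h := (mem_Ioo_of_expBump_ne_zero hab hy).2
  rw [mem_closedBall_zero_iff]
  refine Real.le_sqrt_of_sq_le ?_
  rw [le_div_iff₀ hs]
  linarith

lemma continuous_expBump_norm (s : ℝ) :
    Continuous fun y : EuclideanSpace ℝ (Fin d) => expBump a b (s * ‖y‖ ^ 2) :=
  continuous_expBump.comp (by fun_prop)

lemma integrable_expBump_norm (hab : a ≤ b) {s : ℝ} (hs : 0 < s)
    (ν : Measure (EuclideanSpace ℝ (Fin d))) [IsFiniteMeasureOnCompacts ν] :
    Integrable (fun y => expBump a b (s * ‖y‖ ^ 2)) ν :=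
  (continuous_expBump_norm s).integrable_of_hasCompactSupport (hasCompactSupport_expBump hab hs)

lemma integral_expBump_norm {s : ℝ} (hs : 0 < s) :
    ∫ y : EuclideanSpace ℝ (Fin d), expBump a b (s * ‖y‖ ^ 2)
      = s ^ (-(d : ℝ) / 2) * ∫ y : EuclideanSpace ℝ (Fin d), expBump a b (‖y‖ ^ 2) := by
  rw [← integral_comp_sqrt_smul hs]
  congr 1
  ext y
  rw [norm_smul, Real.norm_eq_abs, abs_of_nonneg (Real.sqrt_nonneg s), mul_pow, Real.sq_sqrt hs.le]

lemma lintegral_expBump_eq (h : IsUnimodalMeasure μ w) (s : ℝ) :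
    ∫⁻ y, ENNReal.ofReal (expBump a b (s * ‖y‖ ^ 2)) ∂μ
      = ∫⁻ y, w y * ENNReal.ofReal (expBump a b (s * ‖y‖ ^ 2)) := by
  refine h.lintegral_eq (continuous_expBump_norm s).measurable.ennreal_ofReal ?_
  simp [expBump]

/-- Where the bump is nonzero, `|y| > |x|`, so the density there is at most its value at `x`. In
`le_integral_expBump` the support lies inside `|x|` and the inequality reverses. -/
lemma integral_expBump_le [IsFiniteMeasure μ] (h : IsUnimodalMeasure μ w) (hb : 1 ≤ b)
    {x : EuclideanSpace ℝ (Fin d)} (hx : x ≠ 0) {p : ℝ} (hp : 0 ≤ p) (hwp : w x = ENNReal.ofReal p)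
    {s : ℝ} (hs : 0 < s) (hsx : s * ‖x‖ ^ 2 = 1) :
    ∫ y, expBump 1 b (s * ‖y‖ ^ 2) ∂μ ≤ p * ∫ y : EuclideanSpace ℝ (Fin d), expBump 1 b (s * ‖y‖ ^ 2) := by
  have h1 : ∫⁻ y, w y * ENNReal.ofReal (expBump 1 b (s * ‖y‖ ^ 2))
      ≤ ∫⁻ y : EuclideanSpace ℝ (Fin d), w x * ENNReal.ofReal (expBump 1 b (s * ‖y‖ ^ 2)) := by
    refine lintegral_mono fun y => ?_
    rcases eq_or_ne (expBump 1 b (s * ‖y‖ ^ 2)) 0 with h0 | h0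
    · simp [h0]
    · have h2 := (mem_Ioo_of_expBump_ne_zero hb h0).1
      rw [← hsx] at h2
      have h3 := lt_of_mul_lt_mul_left h2 hs.le
      gcongr
      exact h.anti x y hx (abs_le_of_sq_le_sq' h3.le (norm_nonneg y)).2
  rw [← h.lintegral_expBump_eq, lintegral_const_mul' _ _ (hwp ▸ ENNReal.ofReal_ne_top), hwp,
    ← ofReal_integral_eq_lintegral_ofReal (integrable_expBump_norm hb hs μ)
      (ae_of_all _ fun y => expBump_nonneg _),
    ← ofReal_integral_eq_lintegral_ofReal (integrable_expBump_norm hb hs volume)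
      (ae_of_all _ fun y => expBump_nonneg _), ← ENNReal.ofReal_mul hp] at h1
  exact (ENNReal.ofReal_le_ofReal_iff
    (mul_nonneg hp (integral_nonneg fun y => expBump_nonneg _))).mp h1

lemma le_integral_expBump [IsFiniteMeasure μ] (h : IsUnimodalMeasure μ w) (ha1 : a ≤ 1)
    {x : EuclideanSpace ℝ (Fin d)} {p : ℝ} (hp : 0 ≤ p) (hwp : w x = ENNReal.ofReal p)
    {s : ℝ} (hs : 0 < s) (hsx : s * ‖x‖ ^ 2 = 1) :
    p * ∫ y : EuclideanSpace ℝ (Fin d), expBump a 1 (s * ‖y‖ ^ 2)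
      ≤ ∫ y, expBump a 1 (s * ‖y‖ ^ 2) ∂μ := by
  have h1 : ∫⁻ y : EuclideanSpace ℝ (Fin d), w x * ENNReal.ofReal (expBump a 1 (s * ‖y‖ ^ 2))
      ≤ ∫⁻ y, w y * ENNReal.ofReal (expBump a 1 (s * ‖y‖ ^ 2)) := by
    refine lintegral_mono fun y => ?_
    rcases eq_or_ne (expBump a 1 (s * ‖y‖ ^ 2)) 0 with h0 | h0
    · simp [h0]
    · have h2 := (mem_Ioo_of_expBump_ne_zero ha1 h0).2
      rw [← hsx] at h2
      have h3 := lt_of_mul_lt_mul_left h2 hs.le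
      gcongr
      refine h.anti y x ?_ (abs_le_of_sq_le_sq' h3.le (norm_nonneg x)).2
      rintro rfl
      simp [expBump] at h0
  rw [← h.lintegral_expBump_eq, lintegral_const_mul' _ _ (hwp ▸ ENNReal.ofReal_ne_top), hwp,
    ← ofReal_integral_eq_lintegral_ofReal (integrable_expBump_norm ha1 hs μ)
      (ae_of_all _ fun y => expBump_nonneg _),
    ← ofReal_integral_eq_lintegral_ofReal (integrable_expBump_norm ha1 hs volume)
      (ae_of_all _ fun y => expBump_nonneg _), ← ENNReal.ofReal_mul hp] at h1
  exact (ENNReal.ofReal_le_ofReal_iff (integral_nonneg fun y => expBump_nonneg _)).mp h1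

lemma integral_expBump_pos (hd : 0 < d) (ha : 0 < a) (hab : a < b) :
    0 < ∫ y : EuclideanSpace ℝ (Fin d), expBump a b (‖y‖ ^ 2) := by
  have hc := continuous_expBump_norm (d := d) (a := a) (b := b) 1
  have hs := hasCompactSupport_expBump (d := d) hab.le one_pos
  simp only [one_mul] at hc hs
  refine hc.integral_pos_of_hasCompactSupport_nonneg_nonzero hs (fun y => expBump_nonneg _)
    (x := EuclideanSpace.single ⟨0, hd⟩ √((a + b) / 2)) (ne_of_gt (expBump_pos ha ?_))
  rw [PiLp.norm_single, Real.norm_eq_abs, sq_abs, Real.sq_sqrt (by linarith)]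
  constructor <;> linarith

end IsUnimodalMeasure

/-! ### Convergence of the rescaled law and of the density ratio. -/

namespace IsUnimodalSemigroup

variable {d : ℕ} {μ : ℝ≥0 → Measure (EuclideanSpace ℝ (Fin d))}
  {w : ℝ≥0 → EuclideanSpace ℝ (Fin d) → ℝ≥0∞} {ψ : ℝ → ℝ}

/-- The rescaled law of `|X_t|²`. -/
noncomputable def scaledLaw (μ : ℝ≥0 → Measure (EuclideanSpace ℝ (Fin d))) (ψ : ℝ → ℝ)
    (z : ℝ≥0 × EuclideanSpace ℝ (Fin d)) : Measure ℝ :=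
  ENNReal.ofReal (z.1 * auxH d ψ (‖z.2‖ ^ (-2 : ℝ)))⁻¹ •
    (μ z.1).map fun y => ‖z.2‖ ^ (-2 : ℝ) * ‖y‖ ^ 2

lemma isFiniteMeasure_scaledLaw (h : IsUnimodalSemigroup μ w ψ)
    (z : ℝ≥0 × EuclideanSpace ℝ (Fin d)) : IsFiniteMeasure (scaledLaw μ ψ z) := by
  have := h.prob z.1
  exact Measure.smul_finite _ ENNReal.ofReal_ne_top

lemma ae_nonneg_scaledLaw (z : ℝ≥0 × EuclideanSpace ℝ (Fin d)) :
    ∀ᵐ u ∂scaledLaw μ ψ z, 0 ≤ u := by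
  refine Measure.ae_smul_measure ?_ _
  rw [ae_map_iff (by fun_prop) measurableSet_Ici]
  exact ae_of_all _ fun y => by positivity

lemma integral_scaledLaw {z : ℝ≥0 × EuclideanSpace ℝ (Fin d)}
    (hz : 0 ≤ z.1 * auxH d ψ (‖z.2‖ ^ (-2 : ℝ))) {g : ℝ → ℝ} (hg : Continuous g) :
    ∫ u, g u ∂scaledLaw μ ψ z = (z.1 * auxH d ψ (‖z.2‖ ^ (-2 : ℝ)))⁻¹ *
      ∫ y, g (‖z.2‖ ^ (-2 : ℝ) * ‖y‖ ^ 2) ∂μ z.1 := by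
  rw [scaledLaw, integral_smul_measure, ENNReal.toReal_ofReal (by positivity), smul_eq_mul,
    integral_map (by fun_prop) hg.aestronglyMeasurable]

variable {L : Filter (ℝ≥0 × EuclideanSpace ℝ (Fin d))} {γ : ℝ}

/-- The main term is the ratio of values of `H`. The error involves `ψ(√c/|x|)`, which `psi_mul_le`
reduces to `ψ(1/|x|)`, leaving a multiple of the quantity assumed to vanish. -/
lemma tendsto_truncKernel_scaledLaw (h : IsUnimodalSemigroup μ w ψ)
    (hL : ∀ᶠ z in L, 0 < z.1 ∧ z.2 ≠ 0) (hH : ∀ s, 0 < s → 0 < auxH d ψ s)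
    (hsmall : Tendsto (fun z => z.1 * ψ ‖z.2‖⁻¹ ^ 2 / auxH d ψ (‖z.2‖ ^ (-2 : ℝ))) L (𝓝 0))
    {c : ℝ} (hc : 0 < c)
    (hreg : Tendsto (fun z => auxH d ψ (c * ‖z.2‖ ^ (-2 : ℝ)) / auxH d ψ (‖z.2‖ ^ (-2 : ℝ))) L
      (𝓝 (c ^ γ))) :
    Tendsto (fun z => ∫ u, truncKernel (c * u) ∂scaledLaw μ ψ z) L (𝓝 (c ^ γ)) := by
  obtain ⟨C, hC⟩ := h.exists_abs_integral_truncKernel_sub_le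
  set K := 2 + Real.pi ^ 2 * √c ^ 2 / 4
  have hK : 0 ≤ K := by positivity
  have herr : Tendsto (fun z => |C| * K ^ 2 *
      (z.1 * ψ ‖z.2‖⁻¹ ^ 2 / auxH d ψ (‖z.2‖ ^ (-2 : ℝ)))) L (𝓝 0) := by
    simpa using hsmall.const_mul (|C| * K ^ 2)
  have hdiff : Tendsto (fun z => ∫ u, truncKernel (c * u) ∂scaledLaw μ ψ z
      - auxH d ψ (c * ‖z.2‖ ^ (-2 : ℝ)) / auxH d ψ (‖z.2‖ ^ (-2 : ℝ))) L (𝓝 0) := by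
    refine squeeze_zero_norm' ?_ herr
    filter_upwards [hL] with z ⟨hz1, hz2⟩
    have hr : 0 < ‖z.2‖ := norm_pos_iff.mpr hz2
    set s := ‖z.2‖ ^ (-2 : ℝ) with hs
    have hs0 : 0 < s := Real.rpow_pos_of_pos hr _
    have hsq : √(c * s) = √c * ‖z.2‖⁻¹ := by
      rw [Real.sqrt_mul hc.le, hs, Real.sqrt_eq_rpow (_ ^ _), ← Real.rpow_mul hr.le,
        ← Real.rpow_neg_one]
      norm_num
    have ht : (0 : ℝ) < z.1 := hz1
    have hHs := hH s hs0
    have h1 := hC z.1 (c * s) (by positivity)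
    have h2 := h.psi_mul_le (Real.sqrt_nonneg c) (inv_nonneg.mpr hr.le)
    rw [integral_scaledLaw (g := fun u => truncKernel (c * u)) (by positivity)
      (continuous_truncKernel.comp (by fun_prop))]
    simp only [← mul_assoc]
    rw [← hs]
    have h3 : ((z.1 : ℝ) * auxH d ψ s)⁻¹ * ∫ y, truncKernel (c * s * ‖y‖ ^ 2) ∂μ z.1
        - auxH d ψ (c * s) / auxH d ψ s = ((z.1 : ℝ) * auxH d ψ s)⁻¹ *
        (∫ y, truncKernel (c * s * ‖y‖ ^ 2) ∂μ z.1 - z.1 * auxH d ψ (c * s)) := by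
      field_simp
    rw [h3, norm_mul, Real.norm_eq_abs, abs_of_nonneg (by positivity), Real.norm_eq_abs]
    have h4 : 0 ≤ ψ (√c * ‖z.2‖⁻¹) := h.psi_nonneg (by positivity)
    calc _ ≤ ((z.1 : ℝ) * auxH d ψ s)⁻¹ * (|C| * (z.1 * (K * ψ ‖z.2‖⁻¹)) ^ 2) := by
          gcongr
          refine h1.trans ?_
          rw [hsq]
          gcongr
          exact le_abs_self C
      _ = _ := by field_simp
  simpa using hdiff.add hreg

/-- The bump is `u² e^{-u}` times a continuous function of `e^{-u}`, the form required by the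
Tauberian theorem. -/
lemma tendsto_expBump_scaledLaw (h : IsUnimodalSemigroup μ w ψ) (hγ : 0 ≤ γ) (hγ2 : γ < 2)
    (hk : ∀ c : ℝ, 0 < c →
      Tendsto (fun z => ∫ u, truncKernel (c * u) ∂scaledLaw μ ψ z) L (𝓝 (c ^ γ))) (a b : ℝ) :
    Tendsto (fun z => ∫ u, expBump a b u ∂scaledLaw μ ψ z) L
      (𝓝 (γ / Real.Gamma (2 - γ) * ∫ u in Ioi 0, u ^ (-1 - γ) * expBump a b u)) := by
  have hfin := h.isFiniteMeasure_scaledLaw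
  have key := tendsto_integral_comp_exp_neg hγ hγ2 ae_nonneg_scaledLaw hk
    (f := fun v => max 0 ((v - Real.exp (-b)) * (Real.exp (-a) - v))) (by fun_prop)
  convert! key using 3
  refine setIntegral_congr_fun measurableSet_Ioi fun u (hu : 0 < u) => ?_
  simp only [expBump]
  rw [show 1 - γ = -1 - γ + (2 : ℕ) by push_cast; ring, Real.rpow_add_natCast hu.ne']
  ring

theorem tendsto_density_ratio (h : IsUnimodalSemigroup μ w ψ) (hγ : 0 ≤ γ) (hγ2 : γ < 2)
    {p : ℝ≥0 → EuclideanSpace ℝ (Fin d) → ℝ}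
    (hp : ∀ t x, 0 < t → x ≠ 0 → 0 ≤ p t x ∧ w t x = ENNReal.ofReal (p t x))
    (hL : ∀ᶠ z in L, 0 < z.1 ∧ z.2 ≠ 0) (hH : ∀ s, 0 < s → 0 < auxH d ψ s)
    (hsmall : Tendsto (fun z => z.1 * ψ ‖z.2‖⁻¹ ^ 2 / auxH d ψ (‖z.2‖ ^ (-2 : ℝ))) L (𝓝 0))
    (hreg : ∀ c : ℝ, 0 < c → Tendsto
      (fun z => auxH d ψ (c * ‖z.2‖ ^ (-2 : ℝ)) / auxH d ψ (‖z.2‖ ^ (-2 : ℝ))) L (𝓝 (c ^ γ))) :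
    Tendsto (fun z => p z.1 z.2 / (z.1 * ‖z.2‖ ^ (-(d : ℝ)) * auxH d ψ (‖z.2‖ ^ (-2 : ℝ)))) L
      (𝓝 (γ * Real.pi ^ (-(d : ℝ) / 2) * Real.Gamma ((d : ℝ) / 2) / Real.Gamma (2 - γ))) := by
  have hd : (0 : ℝ) < d := by exact_mod_cast h.dim_pos
  have hG : 0 < Real.Gamma (2 - γ) := Real.Gamma_pos_of_pos (by linarith)
  have hGd : 0 < Real.Gamma ((d : ℝ) / 2) := Real.Gamma_pos_of_pos (by positivity)
  set A := γ * Real.pi ^ (-(d : ℝ) / 2) * Real.Gamma ((d : ℝ) / 2) / Real.Gamma (2 - γ) with hA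
  have hA0 : 0 ≤ A := by positivity
  have hlim := h.tendsto_expBump_scaledLaw hγ hγ2
    fun c hc => h.tendsto_truncKernel_scaledLaw hL hH hsmall hc (hreg c hc)
  set J := fun a b : ℝ => ∫ y : EuclideanSpace ℝ (Fin d), expBump a b (‖y‖ ^ 2) with hJ
  -- The gap between the radial Lebesgue exponent `d/2 - 1` and the limit exponent `-1 - γ`.
  set θ := γ + (d : ℝ) / 2 with hθ
  have hθ0 : 0 ≤ θ := by positivity
  have hconst (a b : ℝ) : A * J a b
      = γ / Real.Gamma (2 - γ) * ∫ u in Ioi 0, u ^ ((d : ℝ) / 2 - 1) * expBump a b u := by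
    rw [hJ]
    simp only
    rw [integral_comp_norm_sq h.dim_pos, hA, neg_div, Real.rpow_neg Real.pi_pos.le]
    field_simp
  have hexp : (d : ℝ) / 2 - 1 - θ = -1 - γ := by rw [hθ]; ring
  have hlow (a b : ℝ) (ha : 0 < a) (hab : a ≤ b) : A * b ^ (-θ) * J a b
      ≤ γ / Real.Gamma (2 - γ) * ∫ u in Ioi 0, u ^ (-1 - γ) * expBump a b u := by
    have h1 := rpow_mul_setIntegral_le ha hab hθ0 ((d : ℝ) / 2 - 1)
    rw [hexp] at h1
    rw [mul_right_comm, hconst, mul_assoc, mul_comm _ (b ^ (-θ))]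
    gcongr
  have hupp (a b : ℝ) (ha : 0 < a) (hab : a ≤ b) :
      γ / Real.Gamma (2 - γ) * ∫ u in Ioi 0, u ^ (-1 - γ) * expBump a b u
      ≤ A * a ^ (-θ) * J a b := by
    have h1 := setIntegral_le_rpow_mul ha hab hθ0 ((d : ℝ) / 2 - 1)
    rw [hexp] at h1
    rw [mul_right_comm, hconst, mul_assoc, mul_comm _ (a ^ (-θ))]
    gcongr
  have hcont : Tendsto (fun b : ℝ => A * b ^ (-θ)) (𝓝 1) (𝓝 A) := by
    have h1 : ContinuousAt (fun b : ℝ => A * b ^ (-θ)) 1 :=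
      continuousAt_const.mul (Real.continuousAt_rpow_const _ _ (Or.inl one_ne_zero))
    simpa [ContinuousAt] using h1
  have hscale (a b : ℝ) (z : ℝ≥0 × EuclideanSpace ℝ (Fin d)) (hz1 : 0 < z.1) (hz2 : z.2 ≠ 0) :
      0 < ‖z.2‖ ^ (-2 : ℝ) ∧ ‖z.2‖ ^ (-2 : ℝ) * ‖z.2‖ ^ 2 = 1 ∧
      (z.1 * auxH d ψ (‖z.2‖ ^ (-2 : ℝ)))⁻¹ *
        (p z.1 z.2 * ∫ y : EuclideanSpace ℝ (Fin d), expBump a b (‖z.2‖ ^ (-2 : ℝ) * ‖y‖ ^ 2))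
      = p z.1 z.2 / (z.1 * ‖z.2‖ ^ (-(d : ℝ)) * auxH d ψ (‖z.2‖ ^ (-2 : ℝ))) * J a b := by
    have hr : 0 < ‖z.2‖ := norm_pos_iff.mpr hz2
    have hs : 0 < ‖z.2‖ ^ (-2 : ℝ) := Real.rpow_pos_of_pos hr _
    refine ⟨hs, ?_, ?_⟩
    · rw [← Real.rpow_natCast, ← Real.rpow_add hr]
      norm_num
    · rw [IsUnimodalMeasure.integral_expBump_norm hs, ← Real.rpow_mul hr.le,
        show (-2 : ℝ) * (-(d : ℝ) / 2) = d by ring, Real.rpow_neg hr.le (d : ℝ)]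
      have := hH _ hs
      generalize ‖z.2‖ ^ (-2 : ℝ) = s at *
      have ht : (0 : ℝ) < z.1 := hz1
      have hrd : 0 < ‖z.2‖ ^ (d : ℝ) := Real.rpow_pos_of_pos hr _
      change _ * (_ * (_ * J a b)) = _
      field_simp
  -- Bumps on `(1, b)` yield the lower bound and bumps on `(a, 1)` the upper one; the endpoint is
  -- fixed near `1` before the limit along `L` is taken.
  rw [tendsto_order]
  constructor
  · intro x hx
    obtain ⟨b, hb, hb1⟩ := (((hcont.mono_left nhdsWithin_le_nhds).eventually (lt_mem_nhds hx)).and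
      (self_mem_nhdsWithin (s := Ioi (1 : ℝ)))).exists
    have hJ0 : 0 < J 1 b := IsUnimodalMeasure.integral_expBump_pos h.dim_pos one_pos hb1
    have h1 : x * J 1 b < γ / Real.Gamma (2 - γ) *
        ∫ u in Ioi 0, u ^ (-1 - γ) * expBump 1 b u :=
      (mul_lt_mul_of_pos_right hb hJ0).trans_le (hlow 1 b one_pos hb1.le)
    filter_upwards [hL, (hlim 1 b).eventually (lt_mem_nhds h1)] with z ⟨hz1, hz2⟩ hz
    have := h.prob z.1
    obtain ⟨hs, hsx, heq⟩ := hscale 1 b z hz1 hz2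
    have hHs := hH _ hs
    have h2 := (h.unimodal z.1 hz1).integral_expBump_le hb1.le hz2 (hp _ _ hz1 hz2).1
      (hp _ _ hz1 hz2).2 hs hsx
    rw [integral_scaledLaw (by positivity) continuous_expBump] at hz
    refine lt_of_mul_lt_mul_right (hz.trans_le ?_) hJ0.le
    rw [← heq]
    gcongr
  · intro x hx
    obtain ⟨a, ⟨ha, ha0⟩, ha1⟩ := (((hcont.eventually (gt_mem_nhds hx)).and
      (lt_mem_nhds (zero_lt_one (α := ℝ)))).filter_mono
        (nhdsWithin_le_nhds (s := Iio (1 : ℝ))) |>.and self_mem_nhdsWithin).exists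
    have hJ0 : 0 < J a 1 := IsUnimodalMeasure.integral_expBump_pos h.dim_pos ha0 ha1
    have h1 : γ / Real.Gamma (2 - γ) * ∫ u in Ioi 0, u ^ (-1 - γ) * expBump a 1 u < x * J a 1 :=
      (hupp a 1 ha0 ha1.le).trans_lt (mul_lt_mul_of_pos_right ha hJ0)
    filter_upwards [hL, (hlim a 1).eventually (gt_mem_nhds h1)] with z ⟨hz1, hz2⟩ hz
    have := h.prob z.1
    obtain ⟨hs, hsx, heq⟩ := hscale a 1 z hz1 hz2
    have hHs := hH _ hs
    have h2 := (h.unimodal z.1 hz1).le_integral_expBump ha1.le (hp _ _ hz1 hz2).1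
      (hp _ _ hz1 hz2).2 hs hsx
    rw [integral_scaledLaw (by positivity) continuous_expBump] at hz
    refine lt_of_mul_lt_mul_right (lt_of_le_of_lt ?_ hz) hJ0.le
    rw [← heq]
    gcongr

end IsUnimodalSemigroup

/-! ### Transfer to the Lévy process. -/

lemma measurable_of_radial_antitoneOn {E : Type*} [NormedAddCommGroup E] [MeasurableSpace E]
    [BorelSpace E] {q : ℝ → ℝ} (hq : AntitoneOn q (Ioi 0)) {p : E → ℝ}
    (hp : ∀ x, x ≠ 0 → p x = q ‖x‖) : Measurable fun x => ENNReal.ofReal (p x) := by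
  classical
  -- The value `⊤` on `r ≤ 0` makes the profile antitone on the whole line, hence measurable.
  have hanti : Antitone fun r : ℝ => if r ≤ 0 then ⊤ else ENNReal.ofReal (q r) := by
    intro r s hrs
    simp only
    split_ifs with h1 h2 h2
    · exact le_rfl
    · exact absurd (hrs.trans h1) h2
    · exact le_top
    · exact ENNReal.ofReal_le_ofReal (hq (not_le.mp h2) (not_le.mp h1) hrs)
  have hmeas : Measurable fun x : E => if x = 0 then ENNReal.ofReal (p 0) else
      if ‖x‖ ≤ 0 then ⊤ else ENNReal.ofReal (q ‖x‖) :=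
    Measurable.ite (measurableSet_singleton (0 : E)) measurable_const
      (hanti.measurable.comp measurable_norm)
  convert! hmeas using 1
  ext x
  by_cases hx : x = 0
  · simp [hx]
  · simp [hx, hp x hx]

lemma isUnimodalSemigroup_map {Ω : Type*} [MeasurableSpace Ω] {P : Measure Ω}
    [IsProbabilityMeasure P] {d : ℕ} (hd : 0 < d) {X : ℝ≥0 → Ω → EuclideanSpace ℝ (Fin d)}
    (hX : ∀ t, AEMeasurable (X t) P) {ψ : ℝ → ℝ} (hψ : HasRadialCharExponent P X ψ)
    {p : ℝ≥0 → EuclideanSpace ℝ (Fin d) → ℝ} (hp : IsUnimodalWithDensity P X p) :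
    IsUnimodalSemigroup (fun t => P.map (X t)) (fun t x => ENNReal.ofReal (p t x)) ψ := by
  obtain ⟨q, hq⟩ := hp
  refine ⟨fun t => Measure.isProbabilityMeasure_map (hX t), hψ, fun t ht => ?_, hd⟩
  obtain ⟨hanti, -, hpq, hdens⟩ := hq t ht
  refine ⟨(measurable_of_radial_antitoneOn hanti hpq).aemeasurable, fun x y hx hxy => ?_, hdens⟩
  have hx' : 0 < ‖x‖ := norm_pos_iff.mpr hx
  have hy : y ≠ 0 := norm_pos_iff.mp (hx'.trans_le hxy)
  rw [hpq x hx, hpq y hy]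
  exact ENNReal.ofReal_le_ofReal (hanti hx' (hx'.trans_le hxy) hxy)

/-- Treats both regimes at once: `F` governs `|x|` and `G` governs `|x|^{-2}`. -/
lemma tendsto_density_ratio_jointLimit {Ω : Type*} [MeasurableSpace Ω] {P : Measure Ω}
    [IsProbabilityMeasure P] {d : ℕ} (hd : 0 < d) {X : ℝ≥0 → Ω → EuclideanSpace ℝ (Fin d)}
    (hX : ∀ t, AEMeasurable (X t) P) {ψ : ℝ → ℝ} (hψ : HasRadialCharExponent P X ψ)
    {p : ℝ≥0 → EuclideanSpace ℝ (Fin d) → ℝ} (hp : IsUnimodalWithDensity P X p)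
    {γ : ℝ} (hγ : γ ∈ Ico (0 : ℝ) 2) {F G : Filter ℝ} (hF : ∀ᶠ r in F, 0 < r)
    (hFG : Tendsto (fun r : ℝ => r ^ (-2 : ℝ)) F G) (hH : RegularlyVaries (auxH d ψ) G γ) :
    Tendsto
      (fun z : ℝ≥0 × EuclideanSpace ℝ (Fin d) =>
        p z.1 z.2 / (z.1 * ‖z.2‖ ^ (-(d : ℝ)) * auxH d ψ (‖z.2‖ ^ (-2 : ℝ))))
      (jointLimit F (fun t r => t * ψ r⁻¹ ^ 2 / auxH d ψ (r ^ (-2 : ℝ))))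
      (𝓝 (γ * Real.pi ^ (-(d : ℝ) / 2) * Real.Gamma ((d : ℝ) / 2) / Real.Gamma (2 - γ))) := by
  set L := jointLimit (d := d) F (fun t r => t * ψ r⁻¹ ^ 2 / auxH d ψ (r ^ (-2 : ℝ))) with hL
  have hnorm : Tendsto (fun z : ℝ≥0 × EuclideanSpace ℝ (Fin d) => ‖z.2‖) L F :=
    tendsto_comap.mono_left (inf_le_left.trans inf_le_left)
  have hsmall : Tendsto (fun z : ℝ≥0 × EuclideanSpace ℝ (Fin d) =>
      z.1 * ψ ‖z.2‖⁻¹ ^ 2 / auxH d ψ (‖z.2‖ ^ (-2 : ℝ))) L (𝓝 0) :=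
    tendsto_comap.mono_left (inf_le_left.trans inf_le_right)
  have hpos : ∀ᶠ z : ℝ≥0 × EuclideanSpace ℝ (Fin d) in L, 0 < z.1 :=
    (inf_le_right : L ≤ _) (mem_principal_self _)
  refine (isUnimodalSemigroup_map hd hX hψ hp).tendsto_density_ratio hγ.1 hγ.2
    (fun t x ht hx => ⟨?_, rfl⟩) ?_ hH.1 hsmall fun c hc => (hH.2 c hc).comp (hFG.comp hnorm)
  · obtain ⟨q, hq⟩ := hp
    obtain ⟨-, hq0, hpq, -⟩ := hq t ht
    exact hpq x hx ▸ hq0 _ (norm_pos_iff.mpr hx)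
  · filter_upwards [hpos, hnorm.eventually hF] with z hz1 hz2
    exact ⟨hz1, norm_pos_iff.mp hz2⟩

theorem mainTheorem4 {Ω : Type*} [MeasurableSpace Ω] (P : Measure Ω) [IsProbabilityMeasure P]
    (d : ℕ) (hd : 1 ≤ d) (X : ℝ≥0 → Ω → EuclideanSpace ℝ (Fin d))
    (hX : IsLevyProcess P X)
    (ψ : ℝ → ℝ) (hψ : HasRadialCharExponent P X ψ)
    (p : ℝ≥0 → EuclideanSpace ℝ (Fin d) → ℝ) (hp : IsUnimodalWithDensity P X p)
    (γ γ₁ : ℝ) (hγ : γ ∈ Ico (0 : ℝ) 2) (hγ₁ : γ₁ ∈ Icc (0 : ℝ) 2) :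
    (RegularlyVaries (auxH d ψ) (𝓝[>] 0) γ → RegularlyVaries ψ (𝓝[>] 0) γ₁ →
      Tendsto
        (fun z : ℝ≥0 × EuclideanSpace ℝ (Fin d) =>
          p z.1 z.2 / (z.1 * ‖z.2‖ ^ (-(d : ℝ)) * auxH d ψ (‖z.2‖ ^ (-2 : ℝ))))
        (jointLimit atTop (fun t r => t * ψ r⁻¹ ^ 2 / auxH d ψ (r ^ (-2 : ℝ))))
        (𝓝 (γ * Real.pi ^ (-(d : ℝ) / 2) * Real.Gamma ((d : ℝ) / 2) / Real.Gamma (2 - γ)))) ∧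
    (RegularlyVaries (auxH d ψ) atTop γ → RegularlyVaries ψ atTop γ₁ →
      Tendsto
        (fun z : ℝ≥0 × EuclideanSpace ℝ (Fin d) =>
          p z.1 z.2 / (z.1 * ‖z.2‖ ^ (-(d : ℝ)) * auxH d ψ (‖z.2‖ ^ (-2 : ℝ))))
        (jointLimit (𝓝[>] 0) (fun t r => t * ψ r⁻¹ ^ 2 / auxH d ψ (r ^ (-2 : ℝ))))
        (𝓝 (γ * Real.pi ^ (-(d : ℝ) / 2) * Real.Gamma ((d : ℝ) / 2) / Real.Gamma (2 - γ)))) := by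
  refine ⟨fun hH _ => ?_, fun hH _ => ?_⟩
  · refine tendsto_density_ratio_jointLimit hd hX.aemeasurable hψ hp hγ (eventually_gt_atTop 0) ?_ hH
    refine tendsto_nhdsWithin_iff.mpr ⟨tendsto_rpow_neg_atTop two_pos, ?_⟩
    filter_upwards [eventually_gt_atTop 0] with r hr using Real.rpow_pos_of_pos hr _
  · refine tendsto_density_ratio_jointLimit hd hX.aemeasurable hψ hp hγ self_mem_nhdsWithin ?_ hH
    exact tendsto_rpow_neg_nhdsGT_zero (by norm_num)
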